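/- Let $d\ge 1$, let $\mathbb T^d=\mathbb R^d/\mathbb Z^d$ be the torus of side length one, and for $u\in\mathbb R^d$, $T>0$ let $M_{u,T}(v)=(2\pi T)^{-d/2}\exp\big(-|v-u|^2/(2T)\big)$. A smearing function is a strictly positive $\varphi\in C^\infty(\mathbb T^d)$ with $\varphi(x)=\varphi(-x)$ and $\int\varphi\,dy=1$. For a density $g=g(x,v)\ge 0$ on $\mathbb T^d\times\mathbb R^d$ set $\varrho_g(x)=\int g(x,v)\,dv$ and define the smeared fields by $$\varrho_g^\varphi(x)=\int\varphi(x-y)\varrho_g(y)\,dy,\qquad \varrho_g^\varphi(x)u_g^\varphi(x)=\int\varphi(x-y)g(y,v)\,v\,dy\,dv,$$ $$\varrho_g^\varphi(x) T_g^\varphi(x)=\frac1d\int\varphi(x-y)g(y,v)\,|v-u_g^\varphi(x)|^2\,dy\,dv,$$ and put $M_g^\varphi(x,v)=M_{u_g^\varphi(x),T_g^\varphi(x)}(v)$ and $\mathcal N_q(g)=\sup_{x,v}g(x,v)(1+|v|^q)$. Given a function $f_0$ on $\mathbb T^d\times\mathbb R^d$, a mild solution of the regularized BGK equation $\partial_t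 g+v\cdot\nabla_x g=\varrho_g^\varphi M_g^\varphi-g$ with initial datum $f_0$ is a measurable function $g=g(x,v,t)\ge0$, $t\ge 0$, with $\int g(x,v,t)(1+|v|^2)\,dx\,dv<\infty$ for every $t\ge 0$, such that for all $(x,v,t)$ the following time integral converges and $$g(x,v,t)=e^{-t}f_0(x-vt,v)+\int_0^t e^{-(t-s)}(\varrho_g^\varphi M_g^\varphi)(x-v(t-s),v,s)\,ds.$$ Let $f_0$ be a (measurable) probability density on $\mathbb T^d\times\mathbb R^d$ such that, for some continuous $a\ge0$ on $\mathbb R^d$ and constants $C_1,\alpha>0$, $$a(v)\le f_0(x,v)\le C_1e^{-\alpha|v|^2}\quad\text{for all }(x,v),\qquad C_2:=\int a(v)\,dv>0 .$$ Then there are non-decreasing finite functions $t\mapsto K_{q,t}$, $q\in\mathbb N$, and a non-increasing positive function $t\mapsto A_t$ on $[0,\infty)$, not depending on $\varphi$, such that for every smearing function $\varphi$ there is a mild solution $g$ with initial datum $f_0$ satisfying, for all $q\in\mathbb N$, $x\in\mathbb T^d$ and $t\ge0$, $$|u_g^\varphi(x,t)|+T_g^\varphi(x,t)+\mathcal N_q(g(t))\le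 K_{q,t},$$ $$\varrho_g(x,t)\ge C_2e^{-t},\qquad \varrho_g^\varphi(x,t)\ge C_2e^{-t},\qquad T_g^\varphi(x,t)\ge A_t .$$ Moreover, $g$ is the only mild solution with initial datum $f_0$ in the class of functions $h$ such that, for some integer $q>d+2$, $\sup_{t\le\tau}\mathcal N_q(h(t))<\infty$ for every $\tau>0$. -/

import Mathlib

open MeasureTheory
open scoped ENNReal ContDiff

noncomputable section

namespace BGK

/-- The `d`-dimensional torus of side length one, with its Haar probability measure. -/
abbrev Torus (d : ℕ) : Type := UnitAddTorus (Fin d)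

/-- The space of velocities `ℝ^d`, with the Euclidean norm and Lebesgue measure. -/
abbrev Vel (d : ℕ) : Type := EuclideanSpace ℝ (Fin d)

/-- The canonical projection `ℝ^d → 𝕋^d`. -/
def proj {d : ℕ} (z : Vel d) : Torus d := fun i => ((z i : ℝ) : UnitAddCircle)

/-- The Maxwellian `M_{u,T}(v) = (2πT)^{-d/2} exp(-|v-u|²/(2T))`. -/
def maxwellian {d : ℕ} (u : Vel d) (T : ℝ) (v : Vel d) : ℝ :=
  1 / (2 * Real.pi * T) ^ ((d : ℝ) / 2) * Real.exp (-(‖v - u‖ ^ 2 / (2 * T)))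

/-- Smearing functions: strictly positive, even, smooth functions on the torus with integral one.
Smoothness on `𝕋^d = ℝ^d / ℤ^d` is smoothness of the periodic lift to `ℝ^d`. -/
structure IsSmearing {d : ℕ} (φ : Torus d → ℝ) : Prop where
  smooth : ContDiff ℝ ∞ (fun z : Vel d => φ (proj z))
  pos : ∀ x, 0 < φ x
  even : ∀ x, φ (-x) = φ x
  integral_eq_one : ∫ y, φ y = 1

/-! Fields of a phase space density `g = g(x,v)` (at a fixed time). -/

/-- The local density `ϱ_g(x) = ∫ dv g(x,v)`. -/
def density {d : ℕ} (g : Torus d → Vel d → ℝ) (x : Torus d) : ℝ :=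
  ∫ v, g x v

/-- The smeared density `ϱ_g^φ(x) = ∫ dy φ(x-y) ϱ_g(y)`. -/
def smDensity {d : ℕ} (φ : Torus d → ℝ) (g : Torus d → Vel d → ℝ) (x : Torus d) : ℝ :=
  ∫ y, φ (x - y) * density g y

/-- The smeared velocity: `ϱ_g^φ(x) u_g^φ(x) = ∫ dy dv φ(x-y) g(y,v) v`. -/
def smVelocity {d : ℕ} (φ : Torus d → ℝ) (g : Torus d → Vel d → ℝ) (x : Torus d) : Vel d :=
  (smDensity φ g x)⁻¹ • ∫ p : Torus d × Vel d, (φ (x - p.1) * g p.1 p.2) • p.2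

/-- The smeared temperature:
`ϱ_g^φ(x) T_g^φ(x) = (1/d) ∫ dy dv φ(x-y) g(y,v) |v - u_g^φ(x)|²`. -/
def smTemperature {d : ℕ} (φ : Torus d → ℝ) (g : Torus d → Vel d → ℝ) (x : Torus d) : ℝ :=
  (smDensity φ g x)⁻¹ *
    (1 / (d : ℝ) *
      ∫ p : Torus d × Vel d, φ (x - p.1) * g p.1 p.2 * ‖p.2 - smVelocity φ g x‖ ^ 2)

/-- The gain term `ϱ_g^φ(x) M_g^φ(x,v)`, with `M_g^φ(x,v) = M_{u_g^φ(x), T_g^φ(x)}(v)`. -/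
def gain {d : ℕ} (φ : Torus d → ℝ) (g : Torus d → Vel d → ℝ) (x : Torus d) (v : Vel d) : ℝ :=
  smDensity φ g x * maxwellian (smVelocity φ g x) (smTemperature φ g x) v

/-- `𝒩_q(f) = sup_{x,v} f(x,v) (1 + |v|^q)` for a nonnegative `f`, as an extended nonnegative
number (`∞` if unbounded). -/
def weightedSup {d : ℕ} (q : ℕ) (f : Torus d → Vel d → ℝ) : ℝ≥0∞ :=
  ⨆ (x : Torus d) (v : Vel d), ENNReal.ofReal (f x v * (1 + ‖v‖ ^ q))

/-- `g = g(t,x,v)`, `t ≥ 0`, is a mild solution to the regularized BGK equation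
`∂_t g + v·∇_x g = ϱ_g^φ M_g^φ - g` with initial datum `f₀`: it is a measurable nonnegative
function with finite mass and energy at each time, which satisfies Duhamel's formula at every point.
(The values at `t < 0` play no role; any solution may be set to zero there.) -/
structure IsMildSolution {d : ℕ} (φ : Torus d → ℝ) (f₀ : Torus d → Vel d → ℝ)
    (g : ℝ → Torus d → Vel d → ℝ) : Prop where
  measurable : Measurable (fun p : ℝ × Torus d × Vel d => g p.1 p.2.1 p.2.2)
  nonneg : ∀ t, 0 ≤ t → ∀ x v, 0 ≤ g t x v
  integrable : ∀ t, 0 ≤ t →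
    Integrable (fun p : Torus d × Vel d => g t p.1 p.2 * (1 + ‖p.2‖ ^ 2))
  intervalIntegrable : ∀ t, 0 ≤ t → ∀ x v,
    IntervalIntegrable
      (fun s => Real.exp (-(t - s)) * gain φ (g s) (x - proj ((t - s) • v)) v) volume 0 t
  duhamel : ∀ t, 0 ≤ t → ∀ x v,
    g t x v = Real.exp (-t) * f₀ (x - proj (t • v)) v +
      ∫ s in (0 : ℝ)..t, Real.exp (-(t - s)) * gain φ (g s) (x - proj ((t - s) • v)) v

end BGK

end

/-! Since `φ` is a probability kernel, the smeared fields at `x` are the mass, mean velocity and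
temperature of the single velocity distribution `avg φ g x`, and this average inherits every
pointwise bound in `v` that holds uniformly in space. The problem thus reduces to inequalities for
functions of `v` alone, and no constant depends on `φ`.

The decisive inequality is `exists_localMaxwellian_bound`: if `G (1 + |v|^q) ≤ N` with `q > d + 2`,
the Maxwellian with the moments of `G` satisfies the same bound with `C N`, where `C` depends only
on `d` and `q`, not on lower bounds for mass or temperature. Being linear in `N`, it closes a
Gronwall estimate: Duhamel's formula reproduces the bound `N e^{Ct}`. Dropping the gain term gives
`g ≥ e^{-t} a`, hence a lower bound on the mass. A bounded density with positive mass cannot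
concentrate, so the temperature is bounded below as well (`Controlled.tempLower_le_temp`).

With mass and temperature away from zero and the weighted bound finite, `G ↦ localMaxwellian G` is
Lipschitz in the weighted sup norm (`exists_localMaxwellian_lipschitz`). Successive Picard
differences are then at most `M (L t)^n / n!`, so the iterates converge on every time interval, and
their limit solves Duhamel's formula. The same factorial estimate, applied to two solutions, gives
uniqueness. -/

noncomputable section

/-! ### Polynomial weights and moments of a velocity distribution. -/

namespace BGK

/-- The polynomial velocity weight `1 + |v|^q`. -/
def weight {d : ℕ} (q : ℕ) (v : Vel d) : ℝ := 1 + ‖v‖ ^ q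

lemma weight_pos {d : ℕ} (q : ℕ) (v : Vel d) : 0 < weight q v := by
  unfold weight; positivity

lemma one_le_weight {d : ℕ} (q : ℕ) (v : Vel d) : 1 ≤ weight q v := by
  unfold weight; have : 0 ≤ ‖v‖ ^ q := by positivity
  linarith

lemma continuous_weight {d : ℕ} (q : ℕ) : Continuous (weight (d := d) q) := by
  unfold weight; fun_prop

lemma weight_le_two_mul_weight {d : ℕ} {p q : ℕ} (h : p ≤ q) (v : Vel d) :
    weight p v ≤ 2 * weight q v := by
  unfold weight
  have h0 := norm_nonneg v
  rcases le_total ‖v‖ 1 with h1 | h1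
  · have := pow_le_one₀ (n := p) h0 h1
    have : 0 ≤ ‖v‖ ^ q := by positivity
    linarith
  · have := pow_le_pow_right₀ h1 h
    have : 0 ≤ ‖v‖ ^ q := by positivity
    linarith

/-- Two extra powers of the weight absorb the quadratic growth in `v` of the variation of `log
M_{u,T}(v)`. -/
lemma one_add_sq_mul_weight_le {d : ℕ} (q : ℕ) (v : Vel d) :
    (1 + ‖v‖ ^ 2) * weight q v ≤ 6 * weight (q + 2) v := by
  have h1 := weight_le_two_mul_weight (d := d) (show 2 ≤ q + 2 by omega) v
  have h2 := weight_le_two_mul_weight (d := d) (show q ≤ q + 2 by omega) v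
  unfold weight at *
  have : ‖v‖ ^ (q + 2) = ‖v‖ ^ 2 * ‖v‖ ^ q := by ring
  have : 0 ≤ ‖v‖ ^ (q + 2) := by positivity
  linarith

/-- The second moment of the reciprocal weight. -/
def weightMoment (d q : ℕ) : ℝ := ∫ v : Vel d, (1 + ‖v‖ ^ 2) / weight q v

/-- The integrand decays like `|v|^{-(q-2)}`, which is integrable because `q - 2 > d`. This is where
the threshold `q > d + 2` originates. -/
lemma integrable_weightMoment {d q : ℕ} (hq : d + 2 < q) :
    Integrable (fun v : Vel d => (1 + ‖v‖ ^ 2) / weight q v) := by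
  have h := (integrable_one_add_norm (E := Vel d) (μ := volume) (r := (q - 2 : ℕ))
    (by rw [finrank_euclideanSpace_fin]; exact_mod_cast (by omega))).const_mul (2 ^ q)
  refine h.mono' ?_ (Filter.Eventually.of_forall fun v => ?_)
  · exact (Continuous.div (by fun_prop) (continuous_weight q)
      fun v => (weight_pos q v).ne').aestronglyMeasurable
  · have h0 := norm_nonneg v
    rw [Real.norm_of_nonneg (div_nonneg (by positivity) (weight_pos q v).le),
      div_le_iff₀ (weight_pos q v), Real.rpow_neg (by positivity), Real.rpow_natCast]
    have hp : 0 < (1 + ‖v‖) ^ (q - 2) := by positivity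
    have h1 : (1 + ‖v‖) ^ q ≤ 2 ^ q * weight q v := by
      refine (add_pow_le zero_le_one h0 q).trans ?_
      rw [one_pow]
      have := weight_pos q v
      exact mul_le_mul_of_nonneg_right
        (pow_le_pow_right₀ one_le_two (Nat.sub_le _ _)) this.le
    have h2 : (1 + ‖v‖) ^ q = (1 + ‖v‖) ^ 2 * (1 + ‖v‖) ^ (q - 2) := by
      rw [← pow_add]; congr 1; omega
    have h3 : (2 : ℝ) ^ q * ((1 + ‖v‖) ^ (q - 2))⁻¹ * weight q v
        = (2 ^ q * weight q v) / (1 + ‖v‖) ^ (q - 2) := by field_simp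
    rw [h3, le_div_iff₀ hp]
    calc (1 + ‖v‖ ^ 2) * (1 + ‖v‖) ^ (q - 2) ≤ (1 + ‖v‖) ^ 2 * (1 + ‖v‖) ^ (q - 2) := by
          gcongr; nlinarith
      _ ≤ _ := by rw [← h2]; exact h1

lemma weightMoment_pos {d q : ℕ} (hq : d + 2 < q) : 0 < weightMoment d q := by
  unfold weightMoment
  have hc : Continuous (fun v : Vel d => (1 + ‖v‖ ^ 2) / weight q v) :=
    Continuous.div (by fun_prop) (continuous_weight q) fun v => (weight_pos q v).ne'
  exact integral_pos_of_integrable_nonneg_nonzero (x := 0) hc (integrable_weightMoment hq)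
    (fun v => div_nonneg (by positivity) (weight_pos q v).le)
    (div_pos (by positivity) (weight_pos q _)).ne'

/-- A nonnegative velocity distribution bounded by `N / (1 + |v|^q)`. -/
structure Controlled {d : ℕ} (q : ℕ) (N : ℝ) (G : Vel d → ℝ) : Prop where
  measurable : Measurable G
  nonneg : ∀ v, 0 ≤ G v
  le : ∀ v, G v * weight q v ≤ N

section Moments

variable {d q : ℕ} {N : ℝ} {F G : Vel d → ℝ}

lemma Controlled.le_div (h : Controlled q N G) (v : Vel d) : G v ≤ N / weight q v :=
  (le_div_iff₀ (weight_pos q v)).2 (h.le v)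

lemma Controlled.const_nonneg (h : Controlled q N G) : 0 ≤ N :=
  (mul_nonneg (h.nonneg 0) (weight_pos q 0).le).trans (h.le 0)

lemma integrable_of_norm_le {E : Type*} [NormedAddCommGroup E] (hq : d + 2 < q)
    {F : Vel d → E} (hF : AEStronglyMeasurable F volume)
    (h : ∀ v, ‖F v‖ ≤ N * ((1 + ‖v‖ ^ 2) / weight q v)) : Integrable F :=
  ((integrable_weightMoment hq).const_mul N).mono' hF (Filter.Eventually.of_forall h)

lemma norm_integral_le_of_norm_le_weight {E : Type*} [NormedAddCommGroup E] [NormedSpace ℝ E]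
    (hq : d + 2 < q) {F : Vel d → E} (h : ∀ v, ‖F v‖ ≤ N * ((1 + ‖v‖ ^ 2) / weight q v)) :
    ‖∫ v, F v‖ ≤ N * weightMoment d q := by
  rw [weightMoment, ← integral_const_mul]
  exact norm_integral_le_of_norm_le ((integrable_weightMoment hq).const_mul N)
    (Filter.Eventually.of_forall h)

lemma mul_le_weightMoment {δ x r : ℝ} (v : Vel d) (hx : x * weight q v ≤ δ) (hx0 : 0 ≤ x)
    (hr : r ≤ 1 + ‖v‖ ^ 2) : x * r ≤ δ * ((1 + ‖v‖ ^ 2) / weight q v) := by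
  have hw := weight_pos q v
  have h1 : x ≤ δ / weight q v := (le_div_iff₀ hw).2 hx
  calc x * r ≤ x * (1 + ‖v‖ ^ 2) := by gcongr
    _ ≤ δ / weight q v * (1 + ‖v‖ ^ 2) := by gcongr
    _ = _ := by ring

lemma norm_le_one_add_sq (v : Vel d) : ‖v‖ ≤ 1 + ‖v‖ ^ 2 := by nlinarith [sq_nonneg (‖v‖ - 1)]

lemma one_le_one_add_sq (v : Vel d) : 1 ≤ 1 + ‖v‖ ^ 2 := by nlinarith [sq_nonneg ‖v‖]

lemma sq_le_one_add_sq (v : Vel d) : ‖v‖ ^ 2 ≤ 1 + ‖v‖ ^ 2 := by linarith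

lemma norm_le_moment_zero {δ : ℝ} (h : ∀ v, |F v| * weight q v ≤ δ) (v : Vel d) :
    ‖F v‖ ≤ δ * ((1 + ‖v‖ ^ 2) / weight q v) := by
  simpa using mul_le_weightMoment v (h v) (abs_nonneg _) (one_le_one_add_sq v)

lemma norm_le_moment_one {δ : ℝ} (h : ∀ v, |F v| * weight q v ≤ δ) (v : Vel d) :
    ‖F v • v‖ ≤ δ * ((1 + ‖v‖ ^ 2) / weight q v) := by
  rw [norm_smul]
  exact mul_le_weightMoment v (h v) (abs_nonneg _) (norm_le_one_add_sq v)

lemma norm_le_moment_two {δ : ℝ} (h : ∀ v, |F v| * weight q v ≤ δ) (v : Vel d) :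
    ‖F v * ‖v‖ ^ 2‖ ≤ δ * ((1 + ‖v‖ ^ 2) / weight q v) := by
  rw [norm_mul, Real.norm_of_nonneg (sq_nonneg ‖v‖)]
  exact mul_le_weightMoment v (h v) (abs_nonneg _) (sq_le_one_add_sq v)

lemma Controlled.abs_le (h : Controlled q N G) (v : Vel d) : |G v| * weight q v ≤ N := by
  rw [abs_of_nonneg (h.nonneg v)]; exact h.le v

lemma Controlled.integrable (h : Controlled q N G) (hq : d + 2 < q) : Integrable G :=
  integrable_of_norm_le hq h.measurable.aestronglyMeasurable (norm_le_moment_zero h.abs_le)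

lemma Controlled.integrable_smul (h : Controlled q N G) (hq : d + 2 < q) :
    Integrable (fun v => G v • v) :=
  integrable_of_norm_le hq (h.measurable.smul measurable_id).aestronglyMeasurable
    (norm_le_moment_one h.abs_le)

lemma Controlled.integrable_sq (h : Controlled q N G) (hq : d + 2 < q) :
    Integrable (fun v => G v * ‖v‖ ^ 2) :=
  integrable_of_norm_le hq (h.measurable.mul (by fun_prop)).aestronglyMeasurable
    (norm_le_moment_two h.abs_le)

/-- The mass of a velocity distribution. -/
def mass (G : Vel d → ℝ) : ℝ := ∫ v, G v

/-- The momentum of a velocity distribution. -/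
def momentum (G : Vel d → ℝ) : Vel d := ∫ v, G v • v

/-- The second moment of a velocity distribution. -/
def energy (G : Vel d → ℝ) : ℝ := ∫ v, G v * ‖v‖ ^ 2

/-- The mean velocity of a velocity distribution. -/
def mean (G : Vel d → ℝ) : Vel d := (mass G)⁻¹ • momentum G

/-- The temperature of a velocity distribution. -/
def temp (G : Vel d → ℝ) : ℝ :=
  (mass G)⁻¹ * (1 / (d : ℝ) * ∫ v, G v * ‖v - mean G‖ ^ 2)

/-- The Maxwellian with the same mass, mean velocity and temperature. -/
def localMaxwellian (G : Vel d → ℝ) (v : Vel d) : ℝ :=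
  mass G * maxwellian (mean G) (temp G) v

lemma Controlled.mass_le (h : Controlled q N G) (hq : d + 2 < q) :
    mass G ≤ N * weightMoment d q :=
  (le_abs_self _).trans (norm_integral_le_of_norm_le_weight hq (norm_le_moment_zero h.abs_le))

lemma Controlled.norm_momentum_le (h : Controlled q N G) (hq : d + 2 < q) :
    ‖momentum G‖ ≤ N * weightMoment d q :=
  norm_integral_le_of_norm_le_weight hq (norm_le_moment_one h.abs_le)

lemma Controlled.energy_le (h : Controlled q N G) (hq : d + 2 < q) :
    energy G ≤ N * weightMoment d q :=
  (le_abs_self _).trans (norm_integral_le_of_norm_le_weight hq (norm_le_moment_two h.abs_le))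

lemma Controlled.energy_nonneg (h : Controlled q N G) : 0 ≤ energy G :=
  integral_nonneg fun v => mul_nonneg (h.nonneg v) (sq_nonneg _)

lemma Controlled.temp_nonneg (h : Controlled q N G) : 0 ≤ temp G :=
  mul_nonneg (inv_nonneg.2 (integral_nonneg h.nonneg)) (mul_nonneg (by positivity)
    (integral_nonneg fun v => mul_nonneg (h.nonneg v) (sq_nonneg _)))

lemma mul_norm_sub_sq (x : ℝ) (v u : Vel d) :
    x * ‖v - u‖ ^ 2 = x * ‖v‖ ^ 2 - 2 * inner ℝ u (x • v) + ‖u‖ ^ 2 * x := by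
  rw [norm_sub_sq_real, inner_smul_right, real_inner_comm]; ring

lemma Controlled.integrable_sub_sq (h : Controlled q N G) (hq : d + 2 < q) (u : Vel d) :
    Integrable (fun v => G v * ‖v - u‖ ^ 2) := by
  simp_rw [mul_norm_sub_sq]
  exact ((h.integrable_sq hq).sub (((h.integrable_smul hq).const_inner u).const_mul 2)).add
    ((h.integrable hq).const_mul _)

lemma mass_smul_mean (hm : 0 < mass G) : mass G • mean G = momentum G := by
  rw [mean, smul_smul, mul_inv_cancel₀ hm.ne', one_smul]

lemma Controlled.integral_sub_mean_sq (h : Controlled q N G) (hq : d + 2 < q)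
    (hm : 0 < mass G) :
    ∫ v, G v * ‖v - mean G‖ ^ 2 = energy G - mass G * ‖mean G‖ ^ 2 := by
  simp_rw [mul_norm_sub_sq]
  rw [integral_add, integral_sub, integral_const_mul, integral_const_mul,
    integral_inner (h.integrable_smul hq)]
  · change energy G - 2 * inner ℝ (mean G) (momentum G) + ‖mean G‖ ^ 2 * mass G = _
    rw [← mass_smul_mean hm, inner_smul_right, real_inner_self_eq_norm_sq]; ring
  · exact h.integrable_sq hq
  · exact ((h.integrable_smul hq).const_inner _).const_mul 2
  · exact (h.integrable_sq hq).sub (((h.integrable_smul hq).const_inner _).const_mul 2)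
  · exact (h.integrable hq).const_mul _

lemma mass_mul_temp (hd : 1 ≤ d) (hm : 0 < mass G) :
    d * (mass G * temp G) = ∫ v, G v * ‖v - mean G‖ ^ 2 := by
  have : (0 : ℝ) < d := by exact_mod_cast hd
  unfold temp; field_simp

lemma Controlled.energy_eq (h : Controlled q N G) (hq : d + 2 < q) (hd : 1 ≤ d)
    (hm : 0 < mass G) : energy G = mass G * ‖mean G‖ ^ 2 + d * (mass G * temp G) := by
  rw [mass_mul_temp hd hm, h.integral_sub_mean_sq hq hm]; ring

/-- Volume of the unit ball. -/
def ballVol (d : ℕ) : ℝ := volume.real (Metric.ball (0 : Vel d) 1)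

lemma ballVol_pos : 0 < ballVol d :=
  ENNReal.toReal_pos (Metric.measure_ball_pos volume _ one_pos).ne' measure_ball_lt_top.ne

/-- Chebyshev's inequality: inside the ball about the mean the mass is at most `K` times the volume,
outside it is controlled by the variance. -/
lemma Controlled.mass_le_ball (h : Controlled q N G) (hq : d + 2 < q) (hd : 1 ≤ d)
    (hm : 0 < mass G) {K R : ℝ} (hR : 0 < R) (hK : ∀ v, ‖v - mean G‖ ≤ R → G v ≤ K) :
    mass G ≤ K * (R ^ d * ballVol d) + d * (mass G * temp G) / R ^ 2 := by
  set u := mean G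
  have hvol : volume.real (Metric.closedBall u R) = R ^ d * ballVol d := by
    rw [ballVol, measureReal_def, measureReal_def, Measure.addHaar_closedBall _ _ hR.le,
      ENNReal.toReal_mul, ENNReal.toReal_ofReal (by positivity), finrank_euclideanSpace_fin]
  have hi : Integrable ((Metric.closedBall u R).indicator fun _ => K) :=
    (integrable_indicator_iff measurableSet_closedBall).2
      (integrableOn_const (by exact measure_closedBall_lt_top.ne))
  calc mass G ≤ ∫ v, ((Metric.closedBall u R).indicator (fun _ => K) v
        + G v * ‖v - u‖ ^ 2 / R ^ 2) := by
        refine integral_mono (h.integrable hq)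
          (hi.add ((h.integrable_sub_sq hq u).div_const _)) fun v => ?_
        have hG := h.nonneg v
        by_cases hv : ‖v - u‖ ≤ R
        · have : v ∈ Metric.closedBall u R := by simpa [dist_eq_norm] using hv
          simp only [Set.indicator_of_mem this]
          have : 0 ≤ G v * ‖v - u‖ ^ 2 / R ^ 2 := by positivity
          linarith [hK v hv]
        · have : v ∉ Metric.closedBall u R := by simpa [dist_eq_norm] using hv
          simp only [Set.indicator_of_notMem this, zero_add]
          rw [le_div_iff₀ (by positivity)]
          push Not at hv
          gcongr
    _ = _ := by
        rw [integral_add hi ((h.integrable_sub_sq hq u).div_const _),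
          integral_indicator_const _ measurableSet_closedBall, hvol, integral_div,
          mass_mul_temp hd hm, smul_eq_mul]
        ring

end Moments

end BGK

/-! ### Temperature lower bound and the weighted bound on the local Maxwellian. -/

namespace BGK

section Moments

variable {d q : ℕ} {N : ℝ} {G H : Vel d → ℝ}

lemma Controlled.le_const (h : Controlled q N G) (v : Vel d) : G v ≤ N :=
  (le_mul_of_one_le_right (h.nonneg v) (one_le_weight q v)).trans (h.le v)

/-- The lower bound on the temperature of a distribution of mass `m` bounded by `N`. -/
def tempLower (d : ℕ) (m N : ℝ) : ℝ :=
  (m / (2 * (N * ballVol d))) ^ ((2 : ℝ) / d) / (2 * d)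

lemma tempLower_pos (hd : 1 ≤ d) {m : ℝ} (hm : 0 < m) (hN : 0 < N) : 0 < tempLower d m N := by
  have : (0 : ℝ) < d := by exact_mod_cast hd
  have := ballVol_pos (d := d)
  unfold tempLower; positivity

lemma tempLower_le {m m' N' : ℝ} (hm : 0 ≤ m) (hmm : m ≤ m') (hN : 0 < N)
    (hNN : N ≤ N') : tempLower d m N' ≤ tempLower d m' N := by
  have := ballVol_pos (d := d)
  have : 0 < N' := hN.trans_le hNN
  have : 0 ≤ m' := hm.trans hmm
  unfold tempLower
  gcongr

/-- A density bounded by `N` needs room: the radius is chosen so that the ball holds at most half of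
the mass, and the other half forces a variance of order `R²`. -/
lemma Controlled.tempLower_le_temp (h : Controlled q N G) (hq : d + 2 < q) (hd : 1 ≤ d)
    (hN : 0 < N) (hm : 0 < mass G) : tempLower d (mass G) N ≤ temp G := by
  have hd0 : (0 : ℝ) < d := by exact_mod_cast hd
  have hb := ballVol_pos (d := d)
  set x := mass G / (2 * (N * ballVol d)) with hx
  have hx0 : 0 < x := by positivity
  set R := x ^ ((1 : ℝ) / d) with hR
  have hR0 : 0 < R := by positivity
  have hRd : R ^ d = x := by
    rw [hR, ← Real.rpow_natCast, ← Real.rpow_mul hx0.le, one_div, inv_mul_cancel₀ hd0.ne',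
      Real.rpow_one]
  have hR2 : x ^ ((2 : ℝ) / d) = R ^ 2 := by
    rw [hR, ← Real.rpow_natCast, ← Real.rpow_mul hx0.le]; congr 1; push_cast; ring
  have key := h.mass_le_ball hq hd hm hR0 (fun v _ => h.le_const v)
  rw [hRd] at key
  have h1 : N * (x * ballVol d) = mass G / 2 := by rw [hx]; field_simp
  rw [h1] at key
  have h2 : mass G / 2 ≤ d * (mass G * temp G) / R ^ 2 := by linarith
  rw [le_div_iff₀ (by positivity)] at h2
  unfold tempLower
  rw [← hx, hR2, div_le_iff₀ (by positivity)]
  have h3 : mass G * R ^ 2 ≤ mass G * (temp G * (2 * d)) := by linarith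
  exact le_of_mul_le_mul_left h3 hm

lemma Controlled.temp_pos (h : Controlled q N G) (hq : d + 2 < q) (hd : 1 ≤ d)
    (hN : 0 < N) (hm : 0 < mass G) : 0 < temp G :=
  (tempLower_pos hd hm hN).trans_le (h.tempLower_le_temp hq hd hN hm)

/-- The energy is at least `d · mass · temp = 2 R² mass`, and velocities with `|v| ≤ R` account for
at most `R² mass` of it. The remaining `R² mass` comes from the tail, where `G ≤ N / |v|^q`;
rescaling by `R` bounds the tail by a multiple of `N R^{d+2-q}`. -/
lemma Controlled.mass_mul_sqrt_pow_le (h : Controlled q N G) (hq : d + 2 < q) (hd : 1 ≤ d)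
    {R : ℝ} (hR : 0 < R) (hm : 0 < mass G) (hT : d * temp G = 2 * R ^ 2) :
    mass G * R ^ q ≤ 2 * N * weightMoment d q * R ^ d := by
  have hN := h.const_nonneg
  have hint := (integrable_weightMoment hq).comp_smul (R := R⁻¹) (by positivity)
  have key : R ^ q * energy G ≤ R ^ (q + 2) * mass G
      + 2 * N * R ^ 2 * (R ^ d * weightMoment d q) := by
    have e1 : R ^ d * weightMoment d q
        = ∫ v : Vel d, (1 + ‖R⁻¹ • v‖ ^ 2) / weight q (R⁻¹ • v) := by
      rw [Measure.integral_comp_inv_smul volume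
        (fun v : Vel d => (1 + ‖v‖ ^ 2) / weight q v), finrank_euclideanSpace_fin,
        abs_of_pos (by positivity), smul_eq_mul, weightMoment]
    rw [e1, energy, mass, ← integral_const_mul, ← integral_const_mul, ← integral_const_mul,
      ← integral_add ((h.integrable hq).const_mul _) (hint.const_mul _)]
    refine integral_mono ((h.integrable_sq hq).const_mul _)
      (((h.integrable hq).const_mul _).add (hint.const_mul _)) fun v => ?_
    have hw := weight_pos q (R⁻¹ • v)
    have hG := h.nonneg v
    simp only
    by_cases hv : ‖v‖ ≤ R
    · have : 0 ≤ 2 * N * R ^ 2 * ((1 + ‖R⁻¹ • v‖ ^ 2) / weight q (R⁻¹ • v)) := by positivity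
      have h2 : ‖v‖ ^ 2 ≤ R ^ 2 := by gcongr
      have h3 : R ^ q * (G v * ‖v‖ ^ 2) ≤ R ^ q * (G v * R ^ 2) := by gcongr
      have h4 : R ^ q * (G v * R ^ 2) = R ^ (q + 2) * G v := by ring
      linarith
    · push Not at hv
      have h0 : 0 ≤ R ^ (q + 2) * G v := by positivity
      have hnorm : ‖R⁻¹ • v‖ = ‖v‖ / R := by
        rw [norm_smul, Real.norm_of_nonneg (by positivity)]; ring
      set y := ‖v‖ / R with hy
      have hvy : ‖v‖ = R * y := by rw [hy]; field_simp
      have hy1 : 1 ≤ y := by rw [hy, le_div_iff₀ hR]; linarith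
      clear_value y
      have h1 : weight q (R⁻¹ • v) = 1 + y ^ q := by rw [weight, hnorm]
      have hyq : 1 ≤ y ^ q := one_le_pow₀ hy1
      have hGl := h.le v
      rw [weight, hvy, mul_pow] at hGl
      have hGl' : G v * R ^ q * y ^ q ≤ N := by nlinarith
      have h2 : R ^ q * (G v * ‖v‖ ^ 2) ≤
          2 * N * R ^ 2 * ((1 + ‖R⁻¹ • v‖ ^ 2) / weight q (R⁻¹ • v)) := by
        rw [h1, hnorm, hvy, ← mul_div_assoc, le_div_iff₀ (by positivity)]
        have hp : 0 ≤ G v * R ^ q := by positivity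
        have hs : 0 ≤ R ^ 2 * y ^ 2 := by positivity
        calc R ^ q * (G v * (R * y) ^ 2) * (1 + y ^ q)
            = (G v * R ^ q) * (1 + y ^ q) * (R ^ 2 * y ^ 2) := by ring
          _ ≤ (G v * R ^ q) * (y ^ q + y ^ q) * (R ^ 2 * y ^ 2) := by gcongr
          _ = 2 * (G v * R ^ q * y ^ q) * (R ^ 2 * y ^ 2) := by ring
          _ ≤ 2 * N * (R ^ 2 * y ^ 2) := by gcongr
          _ ≤ 2 * N * R ^ 2 * (1 + y ^ 2) := by nlinarith [mul_nonneg hN (sq_nonneg R)]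
      linarith
  have hE := h.energy_eq hq hd hm
  have h5 : mass G * (2 * R ^ 2) ≤ energy G := by
    have : d * (mass G * temp G) = mass G * (2 * R ^ 2) := by rw [← hT]; ring
    have : 0 ≤ mass G * ‖mean G‖ ^ 2 := by positivity
    linarith
  have h6 : R ^ q * (mass G * (2 * R ^ 2)) ≤ R ^ q * energy G := by gcongr
  have h7 : R ^ 2 * (mass G * R ^ q) ≤ R ^ 2 * (2 * N * weightMoment d q * R ^ d) := by
    have : R ^ (q + 2) = R ^ q * R ^ 2 := by ring
    rw [this] at key
    nlinarith
  exact le_of_mul_le_mul_left h7 (by positivity)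

/-- At radius `2R` the variance term in Chebyshev's inequality is exactly half of the mass. -/
lemma Controlled.half_mass_le (h : Controlled q N G) (hq : d + 2 < q) (hd : 1 ≤ d)
    {R K : ℝ} (hR : 0 < R) (hm : 0 < mass G) (hT : d * temp G = 2 * R ^ 2)
    (hK : ∀ v, ‖v - mean G‖ ≤ 2 * R → G v ≤ K) :
    mass G ≤ 2 * K * (2 ^ d * ballVol d) * R ^ d := by
  have key := h.mass_le_ball hq hd hm (R := 2 * R) (by positivity) hK
  have : d * (mass G * temp G) / (2 * R) ^ 2 = mass G / 2 := by
    have : d * (mass G * temp G) = mass G * (2 * R ^ 2) := by rw [← hT]; ring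
    rw [this]; field_simp
  rw [this, mul_pow] at key
  linarith

/-- If the mean is at most `4R`, the bound on `R^q` suffices. Otherwise the ball of radius `2R`
about the mean stays at distance at least `|mean|/2` from the origin; there `G` is at most `N 2^q /
|mean|^q`, and this ball carries half of the mass. -/
lemma Controlled.mass_mul_norm_mean_pow_le (h : Controlled q N G) (hq : d + 2 < q) (hd : 1 ≤ d)
    {R : ℝ} (hR : 0 < R) (hm : 0 < mass G) (hT : d * temp G = 2 * R ^ 2) :
    mass G * ‖mean G‖ ^ q ≤
      (4 ^ q * (2 * weightMoment d q) + 2 * 2 ^ q * (2 ^ d * ballVol d)) * N * R ^ d := by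
  have hN := h.const_nonneg
  have hκ := weightMoment_pos hq
  have hb := ballVol_pos (d := d)
  by_cases hu : ‖mean G‖ ≤ 4 * R
  · have h1 := h.mass_mul_sqrt_pow_le hq hd hR hm hT
    calc mass G * ‖mean G‖ ^ q ≤ mass G * (4 * R) ^ q := by gcongr
      _ = 4 ^ q * (mass G * R ^ q) := by ring
      _ ≤ 4 ^ q * (2 * N * weightMoment d q * R ^ d) := by gcongr
      _ = 4 ^ q * (2 * weightMoment d q) * N * R ^ d := by ring
      _ ≤ _ := by
        gcongr
        have : 0 ≤ 2 * 2 ^ q * (2 ^ d * ballVol d) := by positivity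
        linarith
  · push Not at hu
    have hu0 : 0 < ‖mean G‖ := by linarith
    have h1 := h.half_mass_le hq hd hR hm hT (K := N * 2 ^ q / ‖mean G‖ ^ q) fun v hv => by
      have h2 : ‖mean G‖ / 2 ≤ ‖v‖ := by
        have := norm_sub_norm_le (mean G) v
        rw [norm_sub_rev] at this
        linarith
      have h3 : (‖mean G‖ / 2) ^ q ≤ weight q v := by
        have : (‖mean G‖ / 2) ^ q ≤ ‖v‖ ^ q := by gcongr
        unfold weight; linarith
      rw [le_div_iff₀ (by positivity)]
      calc G v * ‖mean G‖ ^ q = G v * (‖mean G‖ / 2) ^ q * 2 ^ q := by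
            rw [div_pow]; field_simp
        _ ≤ G v * weight q v * 2 ^ q := by
            have := h.nonneg v
            gcongr
        _ ≤ N * 2 ^ q := by gcongr; exact h.le v
    calc mass G * ‖mean G‖ ^ q
        ≤ 2 * (N * 2 ^ q / ‖mean G‖ ^ q) * (2 ^ d * ballVol d) * R ^ d * ‖mean G‖ ^ q := by
          gcongr
      _ = 2 * 2 ^ q * (2 ^ d * ballVol d) * N * R ^ d := by field_simp
      _ ≤ _ := by
        gcongr
        have : 0 ≤ 4 ^ q * (2 * weightMoment d q) := by positivity
        linarith

end Moments

section Maxwellian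

variable {d : ℕ}

lemma pow_mul_exp_neg_sq_le (q : ℕ) {s : ℝ} (hs : 0 ≤ s) :
    s ^ q * Real.exp (-(s ^ 2 / 2)) ≤ 2 ^ q * q.factorial := by
  have hf : (1 : ℝ) ≤ q.factorial := by exact_mod_cast q.factorial_pos
  have h2 : (1 : ℝ) ≤ 2 ^ q := one_le_pow₀ one_le_two
  rcases le_total s 1 with h1 | h1
  · have : s ^ q * Real.exp (-(s ^ 2 / 2)) ≤ 1 * 1 := by
      gcongr
      · exact pow_le_one₀ hs h1
      · exact Real.exp_le_one_iff.2 (by nlinarith [sq_nonneg s])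
    nlinarith
  · have h3 := Real.pow_div_factorial_le_exp (s ^ 2 / 2) (by positivity) q
    rw [div_le_iff₀ (by positivity), div_pow, div_le_iff₀ (by positivity)] at h3
    have h4 : s ^ q ≤ (s ^ 2) ^ q := by
      gcongr; nlinarith
    rw [Real.exp_neg, ← div_eq_mul_inv, div_le_iff₀ (Real.exp_pos _)]
    nlinarith

lemma maxwellian_eq {T : ℝ} (hT : 0 < T) (u v : Vel d) :
    maxwellian u T v = 1 / √(2 * Real.pi * T) ^ d * Real.exp (-(‖v - u‖ ^ 2 / (2 * T))) := by
  have : 0 < 2 * Real.pi * T := by positivity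
  rw [maxwellian, Real.sqrt_eq_rpow, ← Real.rpow_natCast (_ ^ _), ← Real.rpow_mul this.le]
  congr 4; ring

lemma maxwellian_nonneg {T : ℝ} (hT : 0 ≤ T) (u v : Vel d) : 0 ≤ maxwellian u T v := by
  unfold maxwellian; positivity

/-- Splitting `|v|^q` between `|v - u|^q` and `|u|^q`, the Gaussian absorbs the former at the price
of `T^{q/2}`; the normalization contributes `T^{-d/2}`. -/
lemma maxwellian_mul_weight_le (q : ℕ) {T : ℝ} (hT : 0 < T) (u v : Vel d) :
    maxwellian u T v * weight q v ≤ 2 ^ q * (2 ^ q * q.factorial) *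
      ((1 + ‖u‖ ^ q + √T ^ q) / √T ^ d) := by
  have hS : 0 < √T := Real.sqrt_pos.2 hT
  have hST : √T ^ 2 = T := Real.sq_sqrt hT.le
  set S := √T
  set c : ℝ := 2 ^ q * q.factorial with hc
  have hc1 : 1 ≤ c := by
    have hf : (1 : ℝ) ≤ q.factorial := by exact_mod_cast q.factorial_pos
    have h2 : (1 : ℝ) ≤ 2 ^ q := one_le_pow₀ one_le_two
    nlinarith
  set e := Real.exp (-(‖v - u‖ ^ 2 / (2 * T))) with he
  have he0 : 0 < e := Real.exp_pos _
  have he1 : e ≤ 1 := Real.exp_le_one_iff.2 (by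
    have : 0 ≤ ‖v - u‖ ^ 2 / (2 * T) := by positivity
    linarith)
  have h1 : ‖v - u‖ ^ q * e ≤ S ^ q * c := by
    have := pow_mul_exp_neg_sq_le q (s := ‖v - u‖ / S) (by positivity)
    have h' : (‖v - u‖ / S) ^ 2 / 2 = ‖v - u‖ ^ 2 / (2 * T) := by
      rw [div_pow, hST]; field_simp
    rw [h', div_pow, div_mul_eq_mul_div, div_le_iff₀ (by positivity)] at this
    linarith
  have h2 : ‖v‖ ^ q ≤ 2 ^ q * (‖v - u‖ ^ q + ‖u‖ ^ q) := by
    have h3 : ‖v‖ ≤ ‖v - u‖ + ‖u‖ := by simpa using norm_add_le (v - u) u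
    calc ‖v‖ ^ q ≤ (‖v - u‖ + ‖u‖) ^ q := by gcongr
      _ ≤ 2 ^ (q - 1) * (‖v - u‖ ^ q + ‖u‖ ^ q) :=
        add_pow_le (norm_nonneg _) (norm_nonneg _) q
      _ ≤ _ := by
        gcongr
        · exact one_le_two
        · omega
  have h3 : e * weight q v ≤ 2 ^ q * c * (1 + ‖u‖ ^ q + S ^ q) := by
    have h4 : (1 : ℝ) ≤ 2 ^ q := one_le_pow₀ one_le_two
    have h5 : e * 1 ≤ 2 ^ q * c := by nlinarith
    have h6 : e * ‖u‖ ^ q ≤ c * ‖u‖ ^ q := by gcongr; linarith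
    calc e * weight q v ≤ e * (1 + 2 ^ q * (‖v - u‖ ^ q + ‖u‖ ^ q)) := by
          unfold weight; gcongr
      _ = e * 1 + 2 ^ q * (‖v - u‖ ^ q * e + e * ‖u‖ ^ q) := by ring
      _ ≤ 2 ^ q * c + 2 ^ q * (S ^ q * c + c * ‖u‖ ^ q) := by gcongr
      _ = _ := by ring
  have h7 : 1 / √(2 * Real.pi * T) ^ d ≤ 1 / S ^ d := by
    have : S ≤ √(2 * Real.pi * T) := by
      apply Real.sqrt_le_sqrt
      nlinarith [Real.pi_gt_three]
    gcongr
  rw [maxwellian_eq hT]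
  calc 1 / √(2 * Real.pi * T) ^ d * e * weight q v
      = 1 / √(2 * Real.pi * T) ^ d * (e * weight q v) := by ring
    _ ≤ 1 / S ^ d * (2 ^ q * c * (1 + ‖u‖ ^ q + S ^ q)) := by
        have := weight_pos q v
        gcongr
    _ = _ := by ring

end Maxwellian

/-- Each of `mass`, `mass |mean|^q` and `mass T^{q/2}` is at most a multiple of `N R^d`, with `R`
proportional to `√T`. This factor cancels the singular `T^{-d/2}`, so neither mass nor temperature
remains in the constant. -/
lemma exists_localMaxwellian_bound {d q : ℕ} (hd : 1 ≤ d) (hq : d + 2 < q) :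
    ∃ C : ℝ, 0 ≤ C ∧ ∀ (N : ℝ) (G : Vel d → ℝ), Controlled q N G → 0 < N → 0 < mass G →
      ∀ v, localMaxwellian G v * weight q v ≤ C * N := by
  have hκ := weightMoment_pos hq
  have hb := ballVol_pos (d := d)
  have hd0 : (0 : ℝ) < d := by exact_mod_cast hd
  -- With this `b`, the radius `R = b √T` satisfies `d T = 2 R²`, as the moment estimates require.
  set b := √((d : ℝ) / 2) with hbdef
  have hb0 : 0 < b := Real.sqrt_pos.2 (by positivity)
  have hb2 : b ^ 2 = d / 2 := Real.sq_sqrt (by positivity)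
  set c₁ := 2 * (2 ^ d * ballVol d)
  set c₂ := 4 ^ q * (2 * weightMoment d q) + 2 * 2 ^ q * (2 ^ d * ballVol d)
  set c₃ := 2 * weightMoment d q / b ^ q
  set D : ℝ := 2 ^ q * (2 ^ q * q.factorial)
  refine ⟨D * ((c₁ + c₂ + c₃) * b ^ d), by positivity, fun N G h hN hm v => ?_⟩
  have hT := h.temp_pos hq hd hN hm
  set S := √(temp G) with hSdef
  have hS : 0 < S := Real.sqrt_pos.2 hT
  have hST : S ^ 2 = temp G := Real.sq_sqrt hT.le
  have hR : 0 < b * S := by positivity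
  have hRT : d * temp G = 2 * (b * S) ^ 2 := by rw [mul_pow, hb2, hST]; ring
  have k1 := h.half_mass_le hq hd hR hm hRT (fun v _ => h.le_const v)
  have k2 := h.mass_mul_norm_mean_pow_le hq hd hR hm hRT
  have k3 : mass G * S ^ q ≤ c₃ * N * (b * S) ^ d := by
    have := h.mass_mul_sqrt_pow_le hq hd hR hm hRT
    rw [mul_pow b S q] at this
    calc mass G * S ^ q = (mass G * (b ^ q * S ^ q)) / b ^ q := by field_simp
      _ ≤ 2 * N * weightMoment d q * (b * S) ^ d / b ^ q := by gcongr
      _ = _ := by simp only [c₃]; ring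
  have k0 := maxwellian_mul_weight_le q hT (mean G) v
  have hD : 0 ≤ D := by positivity
  calc localMaxwellian G v * weight q v
      = mass G * (maxwellian (mean G) (temp G) v * weight q v) := by
        unfold localMaxwellian; ring
    _ ≤ mass G * (D * ((1 + ‖mean G‖ ^ q + S ^ q) / S ^ d)) := by gcongr
    _ = D * ((mass G + mass G * ‖mean G‖ ^ q + mass G * S ^ q) / S ^ d) := by ring
    _ ≤ D * ((c₁ * N * (b * S) ^ d + c₂ * N * (b * S) ^ d + c₃ * N * (b * S) ^ d) / S ^ d) := by
        gcongr
        simp only [c₁]; linarith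
    _ = _ := by rw [mul_pow]; field_simp

end BGK

/-! ### Lipschitz dependence of the local Maxwellian on the distribution. -/

namespace BGK

lemma abs_exp_sub_exp_le (x y : ℝ) :
    |Real.exp x - Real.exp y| ≤ (Real.exp x + Real.exp y) * |x - y| := by
  have key : ∀ x y : ℝ, Real.exp x - Real.exp y ≤ Real.exp x * |x - y| := fun x y => by
    have h1 := Real.add_one_le_exp (y - x)
    have h2 : Real.exp y = Real.exp x * Real.exp (y - x) := by rw [← Real.exp_add]; congr 1; ring
    have h3 := le_abs_self (x - y)
    have h4 := Real.exp_pos x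
    calc Real.exp x - Real.exp y ≤ Real.exp x - Real.exp x * (y - x + 1) := by rw [h2]; gcongr
      _ = Real.exp x * (x - y) := by ring
      _ ≤ _ := by gcongr
  rw [abs_le]
  have h1 := key x y
  have h2 := key y x
  rw [abs_sub_comm] at h2
  have := mul_nonneg (Real.exp_pos x).le (abs_nonneg (x - y))
  have := mul_nonneg (Real.exp_pos y).le (abs_nonneg (x - y))
  constructor <;> linarith

lemma abs_log_sub_log_le {A x y : ℝ} (hA : 0 < A) (hx : A ≤ x) (hy : A ≤ y) :
    |Real.log x - Real.log y| ≤ |x - y| / A := by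
  have key : ∀ x y : ℝ, A ≤ x → A ≤ y → Real.log x - Real.log y ≤ |x - y| / A :=
    fun x y hx hy => by
      have hx0 := hA.trans_le hx
      have hy0 := hA.trans_le hy
      rw [← Real.log_div hx0.ne' hy0.ne']
      calc Real.log (x / y) ≤ x / y - 1 := Real.log_le_sub_one_of_pos (by positivity)
        _ = (x - y) / y := by field_simp
        _ ≤ |x - y| / y := by gcongr; exact le_abs_self _
        _ ≤ |x - y| / A := by gcongr
  rw [abs_le]
  have h2 := key y x hy hx
  rw [abs_sub_comm] at h2
  constructor <;> linarith [key x y hx hy]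

lemma abs_inv_sub_inv_le {A x y : ℝ} (hA : 0 < A) (hx : A ≤ x) (hy : A ≤ y) :
    |x⁻¹ - y⁻¹| ≤ |x - y| / A ^ 2 := by
  have hx0 := hA.trans_le hx
  have hy0 := hA.trans_le hy
  rw [inv_sub_inv hx0.ne' hy0.ne', abs_div, abs_sub_comm, abs_of_pos (mul_pos hx0 hy0)]
  gcongr
  nlinarith

section Maxwellian

variable {d : ℕ}

/-- The logarithm of `ρ M_{u,T}(v)`. -/
def logMaxwellian (ρ : ℝ) (u : Vel d) (T : ℝ) (v : Vel d) : ℝ :=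
  Real.log ρ - d / 2 * Real.log (2 * Real.pi * T) - ‖v - u‖ ^ 2 / (2 * T)

lemma exp_logMaxwellian {ρ T : ℝ} (hρ : 0 < ρ) (hT : 0 < T) (u v : Vel d) :
    Real.exp (logMaxwellian ρ u T v) = ρ * maxwellian u T v := by
  have h : 0 < 2 * Real.pi * T := by positivity
  rw [logMaxwellian, maxwellian, Real.rpow_def_of_pos h, Real.exp_sub, Real.exp_sub,
    Real.exp_log hρ, Real.exp_neg]
  rw [mul_comm (Real.log _)]
  field_simp

/-- The logarithm separates the dependence on `ρ`, `T` and `u` into summands that are Lipschitz once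
`ρ, T ≥ A`; only the quadratic exponent contributes growth in `v`. -/
lemma abs_logMaxwellian_sub_le {A B ρ ρ' T T' : ℝ} {u u' : Vel d} (hA : 0 < A)
    (hρ : A ≤ ρ) (hρ' : A ≤ ρ') (hT : A ≤ T) (hT' : A ≤ T') (hu : ‖u‖ ≤ B) (hu' : ‖u'‖ ≤ B)
    (v : Vel d) :
    |logMaxwellian ρ u T v - logMaxwellian ρ' u' T' v| ≤
      (1 / A + d / (2 * A) + (1 + B ^ 2) / A ^ 2 + (1 + B) / A) * (1 + ‖v‖ ^ 2) *
        (|ρ - ρ'| + ‖u - u'‖ + |T - T'|) := by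
  have hB : 0 ≤ B := (norm_nonneg u).trans hu
  have hT0 := hA.trans_le hT
  have hT0' := hA.trans_le hT'
  have l1 := abs_log_sub_log_le hA hρ hρ'
  have l2 : |Real.log (2 * Real.pi * T) - Real.log (2 * Real.pi * T')| ≤ |T - T'| / A := by
    have h : (2 * Real.pi) ≠ 0 := by positivity
    rw [Real.log_mul h hT0.ne', Real.log_mul h hT0'.ne', add_sub_add_left_eq_sub]
    exact abs_log_sub_log_le hA hT hT'
  have l3 : |‖v - u‖ ^ 2 / (2 * T) - ‖v - u'‖ ^ 2 / (2 * T')| ≤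
      (1 + B ^ 2) / A ^ 2 * (1 + ‖v‖ ^ 2) * |T - T'|
      + (1 + B) / A * (1 + ‖v‖ ^ 2) * ‖u - u'‖ := by
    have e : ‖v - u‖ ^ 2 / (2 * T) - ‖v - u'‖ ^ 2 / (2 * T') =
        ‖v - u‖ ^ 2 / 2 * (T⁻¹ - T'⁻¹) +
        (‖v - u‖ - ‖v - u'‖) * ((‖v - u‖ + ‖v - u'‖) / 2) * T'⁻¹ := by
      field_simp; ring
    have n1 : ‖v - u‖ ≤ ‖v‖ + B := (norm_sub_le v u).trans (by linarith)
    have n2 : ‖v - u'‖ ≤ ‖v‖ + B := (norm_sub_le v u').trans (by linarith)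
    have n3 : |‖v - u‖ - ‖v - u'‖| ≤ ‖u - u'‖ := by
      refine (abs_norm_sub_norm_le _ _).trans ?_
      rw [sub_sub_sub_cancel_left, norm_sub_rev]
    have hv := norm_nonneg v
    have n4 : ‖v - u‖ ^ 2 / 2 ≤ (1 + B ^ 2) * (1 + ‖v‖ ^ 2) := by
      have : ‖v - u‖ ^ 2 ≤ (‖v‖ + B) ^ 2 := by gcongr
      nlinarith [sq_nonneg (‖v‖ - B), mul_nonneg (sq_nonneg B) (sq_nonneg ‖v‖)]
    have n5 : (‖v - u‖ + ‖v - u'‖) / 2 ≤ (1 + B) * (1 + ‖v‖ ^ 2) := by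
      have : ‖v‖ ≤ 1 + ‖v‖ ^ 2 := by nlinarith [sq_nonneg (‖v‖ - 1)]
      have : 0 ≤ B * ‖v‖ ^ 2 := by positivity
      nlinarith
    have i1 := abs_inv_sub_inv_le hA hT hT'
    have i2 : T'⁻¹ ≤ A⁻¹ := by gcongr
    rw [e]
    refine (abs_add_le _ _).trans (add_le_add ?_ ?_)
    · rw [abs_mul, abs_of_nonneg (by positivity : 0 ≤ ‖v - u‖ ^ 2 / 2)]
      calc _ ≤ (1 + B ^ 2) * (1 + ‖v‖ ^ 2) * (|T - T'| / A ^ 2) := by gcongr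
        _ = _ := by ring
    · rw [abs_mul, abs_mul, abs_of_nonneg (by positivity : 0 ≤ (‖v - u‖ + ‖v - u'‖) / 2),
        abs_of_pos (inv_pos.2 hT0')]
      calc _ ≤ ‖u - u'‖ * ((1 + B) * (1 + ‖v‖ ^ 2)) * A⁻¹ := by gcongr
        _ = _ := by ring
  have e : logMaxwellian ρ u T v - logMaxwellian ρ' u' T' v = (Real.log ρ - Real.log ρ')
      - d / 2 * (Real.log (2 * Real.pi * T) - Real.log (2 * Real.pi * T'))
      - (‖v - u‖ ^ 2 / (2 * T) - ‖v - u'‖ ^ 2 / (2 * T')) := by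
    unfold logMaxwellian; ring
  rw [e]
  refine (abs_sub _ _).trans ?_
  refine (add_le_add_left (abs_sub _ _) _).trans ?_
  rw [abs_mul, abs_of_nonneg (by positivity : (0 : ℝ) ≤ d / 2)]
  set r := 1 + ‖v‖ ^ 2 with hr
  have hr1 : 1 ≤ r := by rw [hr]; nlinarith [sq_nonneg ‖v‖]
  have a1 := abs_nonneg (ρ - ρ')
  have a2 := norm_nonneg (u - u')
  have a3 := abs_nonneg (T - T')
  have m1 : |ρ - ρ'| / A ≤ 1 / A * r * (|ρ - ρ'| + ‖u - u'‖ + |T - T'|) := by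
    rw [div_eq_inv_mul, one_div, mul_assoc]
    gcongr
    nlinarith
  have m2 : d / 2 * (|T - T'| / A) ≤ d / (2 * A) * r * (|ρ - ρ'| + ‖u - u'‖ + |T - T'|) := by
    calc d / 2 * (|T - T'| / A) = d / (2 * A) * |T - T'| := by field_simp
      _ ≤ d / (2 * A) * (r * (|ρ - ρ'| + ‖u - u'‖ + |T - T'|)) := by gcongr; nlinarith
      _ = _ := by ring
  have m3 : (1 + B ^ 2) / A ^ 2 * r * |T - T'| ≤
      (1 + B ^ 2) / A ^ 2 * r * (|ρ - ρ'| + ‖u - u'‖ + |T - T'|) := by gcongr; linarith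
  have m4 : (1 + B) / A * r * ‖u - u'‖ ≤
      (1 + B) / A * r * (|ρ - ρ'| + ‖u - u'‖ + |T - T'|) := by gcongr; linarith
  have m5 : d / 2 * |Real.log (2 * Real.pi * T) - Real.log (2 * Real.pi * T')| ≤
      d / 2 * (|T - T'| / A) := by gcongr
  linarith

/-- The logarithmic estimate is exponentiated by `abs_exp_sub_exp_le`. Its factor `1 + |v|²` is
absorbed by the weight of order `q + 2`, in which Maxwellians with parameters in a compact range are
uniformly bounded. -/
lemma exists_maxwellian_lipschitz (d q : ℕ) {A B : ℝ} (hA : 0 < A) (hB : 0 ≤ B) :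
    ∃ L : ℝ, 0 ≤ L ∧ ∀ (ρ ρ' T T' : ℝ) (u u' : Vel d), A ≤ ρ → A ≤ ρ' → ρ ≤ B → ρ' ≤ B →
      A ≤ T → A ≤ T' → T ≤ B → T' ≤ B → ‖u‖ ≤ B → ‖u'‖ ≤ B → ∀ v,
      |ρ * maxwellian u T v - ρ' * maxwellian u' T' v| * weight q v ≤
        L * (|ρ - ρ'| + ‖u - u'‖ + |T - T'|) := by
  set c := 1 / A + d / (2 * A) + (1 + B ^ 2) / A ^ 2 + (1 + B) / A
  set D : ℝ := 2 ^ (q + 2) * (2 ^ (q + 2) * (q + 2).factorial)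
  set M := B * (D * ((1 + B ^ (q + 2) + √B ^ (q + 2)) / √A ^ d))
  have hsA : 0 < √A := Real.sqrt_pos.2 hA
  have bound : ∀ (ρ T : ℝ) (u v : Vel d), A ≤ ρ → ρ ≤ B → A ≤ T → T ≤ B → ‖u‖ ≤ B →
      ρ * maxwellian u T v * weight (q + 2) v ≤ M := fun ρ T u v h1 h2 h3 h4 h5 => by
    have hT := hA.trans_le h3
    have h := maxwellian_mul_weight_le (q + 2) hT u v
    have hp := maxwellian_nonneg hT.le u v
    have hw := weight_pos (q + 2) v
    calc ρ * maxwellian u T v * weight (q + 2) v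
        = ρ * (maxwellian u T v * weight (q + 2) v) := by ring
      _ ≤ B * (D * ((1 + ‖u‖ ^ (q + 2) + √T ^ (q + 2)) / √T ^ d)) := by gcongr
      _ ≤ M := by simp only [M]; gcongr
  -- The 12 is 6 from `one_add_sq_mul_weight_le` times 2 for the two Maxwellians.
  refine ⟨12 * M * c, by positivity, ?_⟩
  intro ρ ρ' T T' u u' h1 h1' h2 h2' h3 h3' h4 h4' h5 h5' v
  have k1 := bound ρ T u v h1 h2 h3 h4 h5
  have k2 := bound ρ' T' u' v h1' h2' h3' h4' h5'
  have hρ := hA.trans_le h1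
  have hρ' := hA.trans_le h1'
  have hT := hA.trans_le h3
  have hT' := hA.trans_le h3'
  have k3 := abs_logMaxwellian_sub_le hA h1 h1' h3 h3' h5 h5' v
  have k4 := abs_exp_sub_exp_le (logMaxwellian ρ u T v) (logMaxwellian ρ' u' T' v)
  rw [exp_logMaxwellian hρ hT, exp_logMaxwellian hρ' hT'] at k4
  have hs : 0 ≤ ρ * maxwellian u T v + ρ' * maxwellian u' T' v :=
    add_nonneg (mul_nonneg hρ.le (maxwellian_nonneg hT.le _ _))
      (mul_nonneg hρ'.le (maxwellian_nonneg hT'.le _ _))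
  have hw := weight_pos q v
  have hc : 0 ≤ c := by positivity
  set δ := |ρ - ρ'| + ‖u - u'‖ + |T - T'|
  have hδ : 0 ≤ δ := by positivity
  calc _ ≤ (ρ * maxwellian u T v + ρ' * maxwellian u' T' v) * (c * (1 + ‖v‖ ^ 2) * δ)
        * weight q v := by
        gcongr; exact k4.trans (by gcongr)
    _ = (ρ * maxwellian u T v + ρ' * maxwellian u' T' v) * ((1 + ‖v‖ ^ 2) * weight q v)
        * (c * δ) := by ring
    _ ≤ (ρ * maxwellian u T v + ρ' * maxwellian u' T' v) * (6 * weight (q + 2) v)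
        * (c * δ) := by
        refine mul_le_mul_of_nonneg_right ?_ (by positivity)
        exact mul_le_mul_of_nonneg_left (one_add_sq_mul_weight_le q v) hs
    _ = 6 * (ρ * maxwellian u T v * weight (q + 2) v
        + ρ' * maxwellian u' T' v * weight (q + 2) v) * (c * δ) := by ring
    _ ≤ 6 * (M + M) * (c * δ) := by gcongr
    _ = _ := by ring

end Maxwellian

section Moments

variable {d q : ℕ} {N : ℝ} {G H : Vel d → ℝ}

lemma Controlled.norm_mean_sq_le (h : Controlled q N G) (hq : d + 2 < q) (hd : 1 ≤ d)
    (hm : 0 < mass G) : ‖mean G‖ ^ 2 + d * temp G ≤ N * weightMoment d q / mass G := by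
  rw [le_div_iff₀ hm]
  have := h.energy_eq hq hd hm
  have := h.energy_le hq
  linarith

lemma Controlled.norm_mean_add_temp_le (h : Controlled q N G) (hq : d + 2 < q) (hd : 1 ≤ d)
    (hm : 0 < mass G) : ‖mean G‖ + temp G ≤ 1 + N * weightMoment d q / mass G := by
  have h1 := h.norm_mean_sq_le hq hd hm
  have h2 := norm_le_one_add_sq (mean G)
  have h3 := h.temp_nonneg
  have : (1 : ℝ) ≤ d := by exact_mod_cast hd
  nlinarith

/-- Mass, momentum and energy are linear in `G`, hence differ by at most `κ δ`. Mean and temperature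
are obtained from them by division by masses at least `m`, through `d T = energy / mass - |mean|²`;
all parameters stay in a fixed compact range. -/
lemma exists_localMaxwellian_lipschitz (hd : 1 ≤ d) (hq : d + 2 < q) {N m : ℝ}
    (hN : 0 < N) (hm : 0 < m) :
    ∃ L : ℝ, 0 ≤ L ∧ ∀ (G H : Vel d → ℝ) (δ : ℝ), Controlled q N G → Controlled q N H →
      m ≤ mass G → m ≤ mass H → (∀ v, |G v - H v| * weight q v ≤ δ) → ∀ v,
      |localMaxwellian G v - localMaxwellian H v| * weight q v ≤ L * δ := by
  have hκ := weightMoment_pos hq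
  have hd1 : (1 : ℝ) ≤ d := by exact_mod_cast hd
  set κ := weightMoment d q
  set P := N * κ with hP
  have hP0 : 0 < P := by positivity
  set A := min m (tempLower d m N)
  have hA : 0 < A := lt_min hm (tempLower_pos hd hm hN)
  set B := 1 + P / m + P
  have hB : 0 ≤ B := by positivity
  obtain ⟨L, hL, hLip⟩ := exists_maxwellian_lipschitz d q hA hB
  have bounds : ∀ G : Vel d → ℝ, Controlled q N G → m ≤ mass G →
      A ≤ mass G ∧ mass G ≤ B ∧ A ≤ temp G ∧ temp G ≤ B ∧ ‖mean G‖ ≤ B := fun G h hG => by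
    have hG0 := hm.trans_le hG
    have h1 := h.norm_mean_add_temp_le hq hd hG0
    have h2 := h.tempLower_le_temp hq hd hN hG0
    have h3 := tempLower_le (d := d) hm.le hG hN le_rfl
    have h4 := h.mass_le hq
    have h5 : N * κ / mass G ≤ P / m := by gcongr
    have h6 := norm_nonneg (mean G)
    have h7 := h.temp_nonneg
    have h8 : 0 < P / m := by positivity
    refine ⟨(min_le_left _ _).trans hG, by simp only [B]; linarith,
      (min_le_right _ _).trans (h3.trans h2), by simp only [B]; linarith,
      by simp only [B]; linarith⟩
  set c₁ := κ / m + P * (κ / m ^ 2) with hc₁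
  have hc₁0 : 0 ≤ c₁ := by positivity
  refine ⟨L * (κ + c₁ + (c₁ + c₁ * (2 * B))), by positivity, ?_⟩
  intro G H δ hG hH hmG hmH hδ v
  have hδ0 : 0 ≤ δ := (mul_nonneg (abs_nonneg _) (weight_pos q 0).le).trans (hδ 0)
  have hG0 := hm.trans_le hmG
  have hH0 := hm.trans_le hmH
  obtain ⟨g1, g2, g3, g4, g5⟩ := bounds G hG hmG
  obtain ⟨h1, h2, h3, h4, h5⟩ := bounds H hH hmH
  have d0 : |mass G - mass H| ≤ δ * κ := by
    have := norm_integral_le_of_norm_le_weight hq (norm_le_moment_zero hδ)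
    rwa [integral_sub (hG.integrable hq) (hH.integrable hq)] at this
  have d1 : ‖momentum G - momentum H‖ ≤ δ * κ := by
    have := norm_integral_le_of_norm_le_weight hq (norm_le_moment_one hδ)
    simp_rw [sub_smul] at this
    rwa [integral_sub (hG.integrable_smul hq) (hH.integrable_smul hq)] at this
  have d2 : |energy G - energy H| ≤ δ * κ := by
    have := norm_integral_le_of_norm_le_weight hq (norm_le_moment_two hδ)
    simp_rw [sub_mul] at this
    rwa [integral_sub (hG.integrable_sq hq) (hH.integrable_sq hq)] at this
  have dinv : |(mass G)⁻¹ - (mass H)⁻¹| ≤ δ * κ / m ^ 2 :=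
    (abs_inv_sub_inv_le hm hmG hmH).trans (by gcongr)
  have ginv : (mass G)⁻¹ ≤ m⁻¹ := by gcongr
  have quot : δ * κ * m⁻¹ + P * (δ * κ / m ^ 2) = c₁ * δ := by rw [hc₁]; field_simp
  have du : ‖mean G - mean H‖ ≤ c₁ * δ := by
    have e : mean G - mean H = (mass G)⁻¹ • (momentum G - momentum H)
        + ((mass G)⁻¹ - (mass H)⁻¹) • momentum H := by
      unfold mean; rw [smul_sub, sub_smul]; abel
    rw [e, ← quot]
    refine (norm_add_le _ _).trans (add_le_add ?_ ?_)
    · rw [norm_smul, Real.norm_of_nonneg (inv_nonneg.2 hG0.le), mul_comm]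
      gcongr
    · rw [norm_smul, mul_comm, Real.norm_eq_abs]
      gcongr
      exact hH.norm_momentum_le hq
  have dE : |(mass G)⁻¹ * energy G - (mass H)⁻¹ * energy H| ≤ c₁ * δ := by
    have e : (mass G)⁻¹ * energy G - (mass H)⁻¹ * energy H =
        (mass G)⁻¹ * (energy G - energy H) + ((mass G)⁻¹ - (mass H)⁻¹) * energy H := by ring
    rw [e, ← quot]
    refine (abs_add_le _ _).trans (add_le_add ?_ ?_)
    · rw [abs_mul, abs_of_nonneg (inv_nonneg.2 hG0.le), mul_comm]
      gcongr
    · rw [abs_mul, mul_comm, abs_of_nonneg hH.energy_nonneg]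
      gcongr
      exact hH.energy_le hq
  have dT : |temp G - temp H| ≤ c₁ * δ + c₁ * δ * (2 * B) := by
    have tG : d * temp G = (mass G)⁻¹ * energy G - ‖mean G‖ ^ 2 := by
      rw [hG.energy_eq hq hd hG0]; field_simp; ring
    have tH : d * temp H = (mass H)⁻¹ * energy H - ‖mean H‖ ^ 2 := by
      rw [hH.energy_eq hq hd hH0]; field_simp; ring
    have e : d * (temp G - temp H) = ((mass G)⁻¹ * energy G - (mass H)⁻¹ * energy H)
        - (‖mean G‖ - ‖mean H‖) * (‖mean G‖ + ‖mean H‖) := by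
      rw [mul_sub, tG, tH]; ring
    calc |temp G - temp H| ≤ d * |temp G - temp H| :=
          le_mul_of_one_le_left (abs_nonneg _) hd1
      _ = |d * (temp G - temp H)| := by rw [abs_mul, abs_of_nonneg (by linarith : (0 : ℝ) ≤ d)]
      _ ≤ _ := by
        rw [e]
        refine (abs_sub _ _).trans (add_le_add dE ?_)
        rw [abs_mul, abs_of_nonneg (by positivity : 0 ≤ ‖mean G‖ + ‖mean H‖)]
        gcongr
        · exact (abs_norm_sub_norm_le _ _).trans du
        · linarith
  refine (hLip _ _ _ _ _ _ g1 h1 g2 h2 g3 h3 g4 h4 g5 h5 v).trans ?_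
  rw [mul_assoc]
  gcongr
  linarith

end Moments

end BGK

/-! ### Smearing as a spatial average; fields as moments of the average; measurability. -/

namespace BGK

variable {d : ℕ}

lemma continuous_proj : Continuous (proj (d := d)) := by
  refine continuous_pi fun i => ?_
  exact (AddCircle.continuous_mk' 1).comp (by fun_prop)

/-- Smoothness of `φ` is given on the periodic lift; continuity descends to the torus through the
quotient map. -/
lemma isQuotientMap_proj : Topology.IsQuotientMap (proj (d := d)) := by
  have h1 : Topology.IsQuotientMap
      (Pi.map fun (_ : Fin d) (r : ℝ) => (r : UnitAddCircle)) :=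
    (IsOpenQuotientMap.piMap fun _ => QuotientAddGroup.isOpenQuotientMap_mk).isQuotientMap
  exact h1.comp (EuclideanSpace.equiv (Fin d) ℝ).toHomeomorph.isQuotientMap

section Kernel

variable {φ : Torus d → ℝ}

lemma IsSmearing.continuous (hφ : IsSmearing φ) : Continuous φ :=
  isQuotientMap_proj.continuous_iff.2 hφ.smooth.continuous

lemma IsSmearing.integrable_sub (hφ : IsSmearing φ) (x : Torus d) :
    Integrable (fun y => φ (x - y)) :=
  (hφ.continuous.comp (continuous_const.sub continuous_id)).integrable_of_hasCompactSupport
    (HasCompactSupport.of_compactSpace _)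

lemma IsSmearing.integral_sub (hφ : IsSmearing φ) (x : Torus d) : ∫ y, φ (x - y) = 1 := by
  have h : ∀ y, φ (x - y) = φ (y - x) := fun y => by rw [← hφ.even, neg_sub]
  simp_rw [h]
  rw [integral_sub_right_eq_self φ x, hφ.integral_eq_one]

lemma IsSmearing.integrable_sub_mul (hφ : IsSmearing φ) (x : Torus d) {F : Torus d → ℝ} {C : ℝ}
    (hF : Measurable F) (hC : ∀ y, |F y| ≤ C) : Integrable (fun y => φ (x - y) * F y) := by
  refine ((hφ.integrable_sub x).mul_const C).mono'
    ((hφ.integrable_sub x).aestronglyMeasurable.mul hF.aestronglyMeasurable)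
    (Filter.Eventually.of_forall fun y => ?_)
  rw [norm_mul, Real.norm_of_nonneg (hφ.pos _).le]
  exact mul_le_mul_of_nonneg_left (hC y) (hφ.pos _).le

lemma IsSmearing.abs_integral_sub_mul_le (hφ : IsSmearing φ) (x : Torus d) {F : Torus d → ℝ}
    {C : ℝ} (hC : ∀ y, |F y| ≤ C) : |∫ y, φ (x - y) * F y| ≤ C := by
  have h : ‖∫ y, φ (x - y) * F y‖ ≤ ∫ y, φ (x - y) * C :=
    norm_integral_le_of_norm_le ((hφ.integrable_sub x).mul_const C)
      (Filter.Eventually.of_forall fun y => by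
        rw [norm_mul, Real.norm_of_nonneg (hφ.pos _).le]
        exact mul_le_mul_of_nonneg_left (hC y) (hφ.pos _).le)
  rwa [integral_mul_const, hφ.integral_sub, one_mul] at h

lemma IsSmearing.le_integral_sub_mul (hφ : IsSmearing φ) (x : Torus d) {F : Torus d → ℝ}
    {C c : ℝ} (hF : Measurable F) (hC : ∀ y, |F y| ≤ C) (hc : ∀ y, c ≤ F y) :
    c ≤ ∫ y, φ (x - y) * F y := by
  have h : ∫ y, φ (x - y) * c ≤ ∫ y, φ (x - y) * F y :=
    integral_mono ((hφ.integrable_sub x).mul_const c) (hφ.integrable_sub_mul x hF hC)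
      fun y => mul_le_mul_of_nonneg_left (hc y) (hφ.pos _).le
  rwa [integral_mul_const, hφ.integral_sub, one_mul] at h

end Kernel

/-- A phase space density bounded by a multiple of `1 / (1 + |v|^q)`. -/
structure PhaseControlled (q : ℕ) (N : ℝ) (g : Torus d → Vel d → ℝ) : Prop where
  measurable : Measurable (fun p : Torus d × Vel d => g p.1 p.2)
  nonneg : ∀ x v, 0 ≤ g x v
  le : ∀ x v, g x v * weight q v ≤ N

/-- The spatial average of a phase space density. -/
def avg (φ : Torus d → ℝ) (g : Torus d → Vel d → ℝ) (x : Torus d) (v : Vel d) : ℝ :=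
  ∫ y, φ (x - y) * g y v

section Average

variable {φ : Torus d → ℝ} {q : ℕ} {N : ℝ} {g h : Torus d → Vel d → ℝ}

lemma PhaseControlled.controlled (hg : PhaseControlled q N g) (x : Torus d) :
    Controlled q N (g x) :=
  ⟨hg.measurable.comp measurable_prodMk_left, hg.nonneg x, hg.le x⟩

lemma PhaseControlled.abs_le_div (hg : PhaseControlled q N g) (x : Torus d) (v : Vel d) :
    |g x v| ≤ N / weight q v := by
  rw [abs_of_nonneg (hg.nonneg x v)]
  exact (hg.controlled x).le_div v

lemma PhaseControlled.measurable_left (hg : PhaseControlled q N g) (v : Vel d) :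
    Measurable (fun y => g y v) :=
  hg.measurable.comp measurable_prodMk_right

/-- Averaging against a probability kernel at fixed `v` preserves pointwise bounds with the same
constant, whatever `φ` is. -/
lemma PhaseControlled.avg (hφ : IsSmearing φ) (hg : PhaseControlled q N g) (x : Torus d) :
    Controlled q N (avg φ g x) where
  measurable := by
    have : StronglyMeasurable (fun p : Vel d × Torus d => φ (x - p.2) * g p.2 p.1) := by
      apply Measurable.stronglyMeasurable
      refine Measurable.mul ?_ (hg.measurable.comp measurable_swap)
      exact (hφ.continuous.comp (continuous_const.sub continuous_snd)).measurable
    exact this.integral_prod_right'.measurable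
  nonneg v := integral_nonneg fun y => mul_nonneg (hφ.pos _).le (hg.nonneg y v)
  le v := by
    rw [← le_div_iff₀ (weight_pos q v)]
    exact (le_abs_self _).trans
      (hφ.abs_integral_sub_mul_le x (C := N / weight q v) fun y => hg.abs_le_div y v)

lemma PhaseControlled.le_avg (hφ : IsSmearing φ) (hg : PhaseControlled q N g) {x : Torus d}
    {v : Vel d} {c : ℝ} (hc : ∀ y, c ≤ g y v) : c ≤ BGK.avg φ g x v :=
  hφ.le_integral_sub_mul x (hg.measurable_left v) (fun y => hg.abs_le_div y v) hc

lemma PhaseControlled.abs_avg_sub_le (hφ : IsSmearing φ) (hg : PhaseControlled q N g)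
    (hh : PhaseControlled q N h) {δ : ℝ} (hδ : ∀ y v, |g y v - h y v| * weight q v ≤ δ)
    (x : Torus d) (v : Vel d) :
    |BGK.avg φ g x v - BGK.avg φ h x v| * weight q v ≤ δ := by
  rw [← le_div_iff₀ (weight_pos q v)]
  have := hφ.abs_integral_sub_mul_le x (F := fun y => g y v - h y v) (C := δ / weight q v)
    fun y => (le_div_iff₀ (weight_pos q v)).2 (hδ y v)
  simp_rw [mul_sub] at this
  rwa [MeasureTheory.integral_sub
    (hφ.integrable_sub_mul x (hg.measurable_left v) fun y => hg.abs_le_div y v)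
    (hφ.integrable_sub_mul x (hh.measurable_left v) fun y => hh.abs_le_div y v)] at this

lemma PhaseControlled.integrable_prod {E : Type*} [NormedAddCommGroup E] [NormedSpace ℝ E]
    (hφ : IsSmearing φ) (hg : PhaseControlled q N g) (hq : d + 2 < q) (x : Torus d)
    {F : Vel d → E} {c : ℝ} (hF : Continuous F) (hF' : ∀ v, ‖F v‖ ≤ c * (1 + ‖v‖ ^ 2)) :
    Integrable (fun p : Torus d × Vel d => (φ (x - p.1) * g p.1 p.2) • F p.2) := by
  have hdom : Integrable (fun p : Torus d × Vel d =>
      φ (x - p.1) * (c * N * ((1 + ‖p.2‖ ^ 2) / weight q p.2))) :=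
    (hφ.integrable_sub x).mul_prod ((integrable_weightMoment hq).const_mul (c * N))
  have hm : Measurable (fun p : Torus d × Vel d => φ (x - p.1)) :=
    (hφ.continuous.comp (continuous_const.sub continuous_fst)).measurable
  refine hdom.mono' ((hm.mul hg.measurable).aestronglyMeasurable.smul
    (hF.comp continuous_snd).aestronglyMeasurable) (Filter.Eventually.of_forall fun p => ?_)
  have h1 := hg.nonneg p.1 p.2
  have h2 := (hφ.pos (x - p.1)).le
  have h3 := (hg.controlled p.1).le_div p.2
  rw [norm_smul, norm_mul, Real.norm_of_nonneg h1, Real.norm_of_nonneg h2, mul_assoc]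
  refine mul_le_mul_of_nonneg_left ?_ h2
  calc g p.1 p.2 * ‖F p.2‖ ≤ N / weight q p.2 * (c * (1 + ‖p.2‖ ^ 2)) :=
        mul_le_mul h3 (hF' _) (norm_nonneg _) (h1.trans h3)
    _ = _ := by ring

/-- Fubini's theorem turns smeared phase space moments into velocity moments of the average; `F =
1`, `v`, `|v - u|²` give the three fields. -/
lemma PhaseControlled.integral_prod {E : Type*} [NormedAddCommGroup E] [NormedSpace ℝ E]
    [CompleteSpace E]
    (hφ : IsSmearing φ) (hg : PhaseControlled q N g) (hq : d + 2 < q) (x : Torus d)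
    {F : Vel d → E} {c : ℝ} (hF : Continuous F) (hF' : ∀ v, ‖F v‖ ≤ c * (1 + ‖v‖ ^ 2)) :
    ∫ p : Torus d × Vel d, (φ (x - p.1) * g p.1 p.2) • F p.2 =
      ∫ v, BGK.avg φ g x v • F v := by
  have h := hg.integrable_prod hφ hq x hF hF'
  rw [Measure.volume_eq_prod] at h ⊢
  rw [integral_prod_symm _ h]
  simp only [integral_smul_const]
  rfl

lemma PhaseControlled.smDensity_eq (hφ : IsSmearing φ) (hg : PhaseControlled q N g)
    (hq : d + 2 < q) (x : Torus d) : smDensity φ g x = mass (BGK.avg φ g x) := by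
  have hF' : ∀ v : Vel d, ‖(1 : ℝ)‖ ≤ 1 * (1 + ‖v‖ ^ 2) := fun v => by
    simp
  have h := hg.integrable_prod hφ hq x (F := fun _ => (1 : ℝ)) continuous_const hF'
  have h' := hg.integral_prod hφ hq x (F := fun _ => (1 : ℝ)) continuous_const hF'
  simp only [smul_eq_mul, mul_one] at h h'
  rw [mass, ← h', smDensity]
  rw [Measure.volume_eq_prod] at h ⊢
  rw [MeasureTheory.integral_prod _ h]
  simp only [integral_const_mul, density]

lemma PhaseControlled.smVelocity_eq (hφ : IsSmearing φ) (hg : PhaseControlled q N g)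
    (hq : d + 2 < q) (x : Torus d) : smVelocity φ g x = mean (BGK.avg φ g x) := by
  rw [smVelocity, mean, momentum, hg.smDensity_eq hφ hq x,
    hg.integral_prod hφ hq x (F := fun v => v) (c := 1) continuous_id
      fun v => by simpa using norm_le_one_add_sq v]

lemma PhaseControlled.smTemperature_eq (hφ : IsSmearing φ) (hg : PhaseControlled q N g)
    (hq : d + 2 < q) (x : Torus d) : smTemperature φ g x = temp (BGK.avg φ g x) := by
  rw [smTemperature, temp, hg.smDensity_eq hφ hq x, hg.smVelocity_eq hφ hq x]
  congr 2
  set u := mean (BGK.avg φ g x)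
  exact hg.integral_prod hφ hq x (F := fun v => ‖v - u‖ ^ 2) (c := 2 * (1 + ‖u‖ ^ 2))
    (by fun_prop) fun v => by
      rw [Real.norm_of_nonneg (sq_nonneg _)]
      have h1 : ‖v - u‖ ^ 2 ≤ (‖v‖ + ‖u‖) ^ 2 := by gcongr; exact norm_sub_le v u
      nlinarith [sq_nonneg (‖v‖ - ‖u‖), mul_nonneg (sq_nonneg ‖u‖) (sq_nonneg ‖v‖)]

lemma PhaseControlled.gain_eq (hφ : IsSmearing φ) (hg : PhaseControlled q N g)
    (hq : d + 2 < q) (x : Torus d) (v : Vel d) :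
    gain φ g x v = localMaxwellian (BGK.avg φ g x) v := by
  rw [gain, localMaxwellian, hg.smDensity_eq hφ hq x, hg.smVelocity_eq hφ hq x,
    hg.smTemperature_eq hφ hq x]

lemma PhaseControlled.le_mass_avg (hφ : IsSmearing φ) (hg : PhaseControlled q N g)
    (hq : d + 2 < q) {a : Vel d → ℝ} (ha : Integrable a) {c : ℝ}
    (hag : ∀ x v, c * a v ≤ g x v) (x : Torus d) : c * ∫ v, a v ≤ mass (BGK.avg φ g x) := by
  rw [← integral_const_mul]
  exact integral_mono (ha.const_mul c) ((hg.avg hφ x).integrable hq)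
    fun v => hg.le_avg hφ fun y => hag y v

end Average

/-- No integrability is needed, since an undefined integral is zero by convention. The lemma thus
applies to mild solutions before any weighted bound is known. -/
lemma gain_nonneg {φ : Torus d → ℝ} (hφ : IsSmearing φ) {g : Torus d → Vel d → ℝ}
    (hg : ∀ x v, 0 ≤ g x v) (x : Torus d) (v : Vel d) : 0 ≤ gain φ g x v := by
  have h1 : 0 ≤ smDensity φ g x := integral_nonneg fun y =>
    mul_nonneg (hφ.pos _).le (integral_nonneg (hg y))
  refine mul_nonneg h1 (maxwellian_nonneg (mul_nonneg (inv_nonneg.2 h1)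
    (mul_nonneg (by positivity) (integral_nonneg fun p => ?_))) _ _)
  exact mul_nonneg (mul_nonneg (hφ.pos _).le (hg _ _)) (sq_nonneg _)

section Measurability

variable {S : Type*} [MeasurableSpace S] {φ : Torus d → ℝ} {g : S → Torus d → Vel d → ℝ}

lemma measurable_smDensity (hφ : IsSmearing φ)
    (hg : Measurable fun p : S × Torus d × Vel d => g p.1 p.2.1 p.2.2) :
    Measurable fun p : S × Torus d => smDensity φ (g p.1) p.2 := by
  have h1 : Measurable fun p : S × Torus d => density (g p.1) p.2 := by
    have : StronglyMeasurable (fun p : (S × Torus d) × Vel d => g p.1.1 p.1.2 p.2) :=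
      (hg.comp (f := fun p : (S × Torus d) × Vel d => (p.1.1, p.1.2, p.2))
        (by fun_prop)).stronglyMeasurable
    exact this.integral_prod_right'.measurable
  have h2 : StronglyMeasurable (fun p : (S × Torus d) × Torus d =>
      φ (p.1.2 - p.2) * density (g p.1.1) p.2) := by
    apply Measurable.stronglyMeasurable
    refine (hφ.continuous.measurable.comp (by fun_prop)).mul ?_
    exact h1.comp (f := fun p : (S × Torus d) × Torus d => (p.1.1, p.2)) (by fun_prop)
  exact h2.integral_prod_right'.measurable

lemma measurable_sub_mul (hφ : IsSmearing φ)
    (hg : Measurable fun p : S × Torus d × Vel d => g p.1 p.2.1 p.2.2) :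
    Measurable fun p : (S × Torus d) × Torus d × Vel d =>
      φ (p.1.2 - p.2.1) * g p.1.1 p.2.1 p.2.2 := by
  refine (hφ.continuous.measurable.comp (by fun_prop)).mul ?_
  exact hg.comp (f := fun p : (S × Torus d) × Torus d × Vel d => (p.1.1, p.2.1, p.2.2))
    (by fun_prop)

lemma measurable_smVelocity (hφ : IsSmearing φ)
    (hg : Measurable fun p : S × Torus d × Vel d => g p.1 p.2.1 p.2.2) :
    Measurable fun p : S × Torus d => smVelocity φ (g p.1) p.2 := by
  have h2 : StronglyMeasurable (fun p : (S × Torus d) × Torus d × Vel d =>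
      (φ (p.1.2 - p.2.1) * g p.1.1 p.2.1 p.2.2) • p.2.2) :=
    ((measurable_sub_mul hφ hg).smul (by fun_prop)).stronglyMeasurable
  exact (measurable_smDensity hφ hg).inv.smul h2.integral_prod_right'.measurable

lemma measurable_smTemperature (hφ : IsSmearing φ)
    (hg : Measurable fun p : S × Torus d × Vel d => g p.1 p.2.1 p.2.2) :
    Measurable fun p : S × Torus d => smTemperature φ (g p.1) p.2 := by
  have hu := measurable_smVelocity hφ hg
  have h2 : StronglyMeasurable (fun p : (S × Torus d) × Torus d × Vel d =>
      φ (p.1.2 - p.2.1) * g p.1.1 p.2.1 p.2.2 * ‖p.2.2 - smVelocity φ (g p.1.1) p.1.2‖ ^ 2) := by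
    apply Measurable.stronglyMeasurable
    refine (measurable_sub_mul hφ hg).mul (((Measurable.sub ?_ ?_).norm).pow_const 2)
    · fun_prop
    · exact hu.comp measurable_fst
  exact (measurable_smDensity hφ hg).inv.mul (h2.integral_prod_right'.measurable.const_mul _)

lemma measurable_gain (hφ : IsSmearing φ)
    (hg : Measurable fun p : S × Torus d × Vel d => g p.1 p.2.1 p.2.2) :
    Measurable fun p : S × Torus d × Vel d => gain φ (g p.1) p.2.1 p.2.2 := by
  have hπ : Measurable fun p : S × Torus d × Vel d => (p.1, p.2.1) := by fun_prop
  have h1 := (measurable_smDensity hφ hg).comp hπ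
  have h2 := (measurable_smVelocity hφ hg).comp hπ
  have h3 := (measurable_smTemperature hφ hg).comp hπ
  have h4 : Measurable fun p : S × Torus d × Vel d => p.2.2 := by fun_prop
  simp only [Function.comp_def] at h1 h2 h3
  unfold gain maxwellian
  fun_prop

end Measurability

end BGK

/-! ### The Duhamel map: contraction and propagated bounds. -/

namespace BGK

variable {d : ℕ}

/-- The right hand side of Duhamel's formula. -/
def duhamelMap (φ : Torus d → ℝ) (f₀ : Torus d → Vel d → ℝ) (g : ℝ → Torus d → Vel d → ℝ)
    (t : ℝ) (x : Torus d) (v : Vel d) : ℝ :=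
  Real.exp (-t) * f₀ (x - proj (t • v)) v +
    ∫ s in Set.Ioc 0 t, Real.exp (-(t - s)) * gain φ (g s) (x - proj ((t - s) • v)) v

/-- Free transport of the initial datum, damped at unit rate. -/
def freeFlow (f₀ : Torus d → Vel d → ℝ) (t : ℝ) (x : Torus d) (v : Vel d) : ℝ :=
  Real.exp (-t) * f₀ (x - proj (t • v)) v

section Measurability

variable {φ : Torus d → ℝ} {f₀ : Torus d → Vel d → ℝ} {g : ℝ → Torus d → Vel d → ℝ}

lemma measurable_freeFlow (hf₀ : Measurable fun p : Torus d × Vel d => f₀ p.1 p.2) :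
    Measurable fun p : ℝ × Torus d × Vel d => freeFlow f₀ p.1 p.2.1 p.2.2 := by
  have hπ : Measurable fun p : ℝ × Torus d × Vel d => p.2.1 - proj (p.1 • p.2.2) :=
    (by fun_prop : Measurable fun p : ℝ × Torus d × Vel d => p.2.1).sub
      (continuous_proj.measurable.comp (by fun_prop))
  exact (by fun_prop : Measurable fun p : ℝ × Torus d × Vel d => Real.exp (-p.1)).mul
    (hf₀.comp (hπ.prodMk (by fun_prop : Measurable fun p : ℝ × Torus d × Vel d => p.2.2)))

lemma measurable_gain_shift (hφ : IsSmearing φ)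
    (hg : Measurable fun p : ℝ × Torus d × Vel d => g p.1 p.2.1 p.2.2) :
    Measurable fun p : (ℝ × Torus d × Vel d) × ℝ => Real.exp (-(p.1.1 - p.2)) *
      gain φ (g p.2) (p.1.2.1 - proj ((p.1.1 - p.2) • p.1.2.2)) p.1.2.2 := by
  have hπ : Measurable fun p : (ℝ × Torus d × Vel d) × ℝ =>
      p.1.2.1 - proj ((p.1.1 - p.2) • p.1.2.2) :=
    (by fun_prop : Measurable fun p : (ℝ × Torus d × Vel d) × ℝ => p.1.2.1).sub
      (continuous_proj.measurable.comp (by fun_prop))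
  have hπ' : Measurable fun p : (ℝ × Torus d × Vel d) × ℝ =>
      (p.2, p.1.2.1 - proj ((p.1.1 - p.2) • p.1.2.2), p.1.2.2) :=
    measurable_snd.prodMk (hπ.prodMk (by fun_prop))
  exact (by fun_prop : Measurable fun p : (ℝ × Torus d × Vel d) × ℝ =>
    Real.exp (-(p.1.1 - p.2))).mul ((measurable_gain hφ hg).comp hπ')

lemma measurable_duhamelMap (hφ : IsSmearing φ)
    (hf₀ : Measurable fun p : Torus d × Vel d => f₀ p.1 p.2)
    (hg : Measurable fun p : ℝ × Torus d × Vel d => g p.1 p.2.1 p.2.2) :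
    Measurable fun p : ℝ × Torus d × Vel d => duhamelMap φ f₀ g p.1 p.2.1 p.2.2 := by
  refine (measurable_freeFlow hf₀).add ?_
  -- The `t`-dependent domain of integration becomes an indicator, so that measurability of
  -- parameter integrals applies.
  have h : StronglyMeasurable fun p : (ℝ × Torus d × Vel d) × ℝ =>
      {p : (ℝ × Torus d × Vel d) × ℝ | 0 < p.2 ∧ p.2 ≤ p.1.1}.indicator
        (fun p => Real.exp (-(p.1.1 - p.2)) *
          gain φ (g p.2) (p.1.2.1 - proj ((p.1.1 - p.2) • p.1.2.2)) p.1.2.2) p :=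
    ((measurable_gain_shift hφ hg).indicator
      ((measurableSet_lt measurable_const measurable_snd).inter
        (measurableSet_le measurable_snd (by fun_prop)))).stronglyMeasurable
  convert (h.integral_prod_right' (ν := volume)).measurable using 2 with p
  rw [← integral_indicator measurableSet_Ioc]
  rfl

end Measurability

/-- Bounds on a time interval that make the gain term Lipschitz. -/
structure Tame (φ : Torus d → ℝ) (q : ℕ) (N m τ : ℝ) (g : ℝ → Torus d → Vel d → ℝ) : Prop where
  measurable : Measurable fun p : ℝ × Torus d × Vel d => g p.1 p.2.1 p.2.2
  controlled : ∀ s, 0 ≤ s → s ≤ τ → PhaseControlled q N (g s)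
  mass : ∀ s, 0 ≤ s → s ≤ τ → ∀ x, m ≤ mass (avg φ (g s) x)

section Tame

variable {φ : Torus d → ℝ} {f₀ : Torus d → Vel d → ℝ} {g h : ℝ → Torus d → Vel d → ℝ}
  {q : ℕ} {N m τ : ℝ}

lemma Tame.integrableOn (hd : 1 ≤ d) (hq : d + 2 < q) (hN : 0 < N) (hm : 0 < m)
    (hφ : IsSmearing φ) (hg : Tame φ q N m τ g) {t : ℝ} (ht : t ≤ τ)
    (x : Torus d) (v : Vel d) :
    IntegrableOn (fun s => Real.exp (-(t - s)) * gain φ (g s) (x - proj ((t - s) • v)) v)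
      (Set.Ioc 0 t) := by
  obtain ⟨C, hC, hgain⟩ := exists_localMaxwellian_bound hd hq
  have hmeas : Measurable fun s =>
      Real.exp (-(t - s)) * gain φ (g s) (x - proj ((t - s) • v)) v :=
    (measurable_gain_shift hφ hg.measurable).comp
      (measurable_prodMk_left (x := (t, x, v)))
  refine Integrable.mono' (g := fun _ => C * N) (integrableOn_const (by simp))
    hmeas.aestronglyMeasurable ?_
  refine ae_restrict_of_forall_mem measurableSet_Ioc fun s hs => ?_
  have hsg := hg.controlled s hs.1.le (hs.2.trans ht)
  have h0 := gain_nonneg hφ hsg.nonneg (x - proj ((t - s) • v)) v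
  rw [Real.norm_of_nonneg (mul_nonneg (Real.exp_pos _).le h0)]
  have h1 : Real.exp (-(t - s)) ≤ 1 := Real.exp_le_one_iff.2 (by linarith [hs.2])
  calc _ ≤ 1 * gain φ (g s) (x - proj ((t - s) • v)) v := by gcongr
    _ ≤ gain φ (g s) (x - proj ((t - s) • v)) v * weight q v := by
      rw [one_mul]; exact le_mul_of_one_le_right h0 (one_le_weight q v)
    _ ≤ C * N := by
      rw [hsg.gain_eq hφ hq]
      exact hgain N _ (hsg.avg hφ _) hN
        (hm.trans_le (hg.mass s hs.1.le (hs.2.trans ht) _)) v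

lemma integral_pow_div_factorial (L M : ℝ) (n : ℕ) (t : ℝ) :
    ∫ s in (0 : ℝ)..t, L * (M * ((L * s) ^ n / n.factorial)) =
      M * ((L * t) ^ (n + 1) / (n + 1).factorial) := by
  have e : ∀ s : ℝ, L * (M * ((L * s) ^ n / n.factorial)) =
      L ^ (n + 1) * M / n.factorial * s ^ n := fun s => by rw [mul_pow]; ring
  simp_rw [e]
  rw [intervalIntegral.integral_const_mul, integral_pow, Nat.factorial_succ, mul_pow]
  have : (n.factorial : ℝ) ≠ 0 := by exact_mod_cast n.factorial_ne_zero
  push_cast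
  have : (n : ℝ) + 1 ≠ 0 := by positivity
  field_simp
  ring

/-- Each application of Duhamel's formula integrates the Lipschitz bound once in time, raising `(L
s)^n / n!` to the next order. Hence no smallness of the time interval is needed. -/
lemma exists_duhamelMap_contraction (hd : 1 ≤ d) (hq : d + 2 < q) (hN : 0 < N) (hm : 0 < m) :
    ∃ L : ℝ, 0 ≤ L ∧ ∀ (φ : Torus d → ℝ) (f₀ : Torus d → Vel d → ℝ) (τ : ℝ)
      (g h : ℝ → Torus d → Vel d → ℝ) (M : ℝ) (n : ℕ), IsSmearing φ → Tame φ q N m τ g →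
      Tame φ q N m τ h →
      (∀ s, 0 ≤ s → s ≤ τ → ∀ x v,
        |g s x v - h s x v| * weight q v ≤ M * ((L * s) ^ n / n.factorial)) →
      ∀ t, 0 ≤ t → t ≤ τ → ∀ x v, |duhamelMap φ f₀ g t x v - duhamelMap φ f₀ h t x v| *
        weight q v ≤ M * ((L * t) ^ (n + 1) / (n + 1).factorial) := by
  obtain ⟨L, hL, hLip⟩ := exists_localMaxwellian_lipschitz hd hq hN hm
  refine ⟨L, hL, fun φ f₀ τ g h M n hφ hg hh hgh t ht htτ x v => ?_⟩
  have hw := weight_pos q v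
  rw [duhamelMap, duhamelMap, add_sub_add_left_eq_sub,
    ← integral_sub (hg.integrableOn hd hq hN hm hφ htτ x v)
      (hh.integrableOn hd hq hN hm hφ htτ x v), ← abs_of_pos hw, ← abs_mul,
    ← integral_mul_const, ← integral_pow_div_factorial, intervalIntegral.integral_of_le ht,
    ← Real.norm_eq_abs]
  refine norm_integral_le_of_norm_le ?_ ?_
  · exact (by fun_prop : Continuous fun s => L * (M * ((L * s) ^ n / n.factorial)))
      |>.integrableOn_Ioc
  refine ae_restrict_of_forall_mem measurableSet_Ioc fun s hs => ?_
  have hs0 := hs.1.le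
  have hsτ := hs.2.trans htτ
  have hgs := hg.controlled s hs0 hsτ
  have hhs := hh.controlled s hs0 hsτ
  set y := x - proj ((t - s) • v)
  have h1 : Real.exp (-(t - s)) ≤ 1 := Real.exp_le_one_iff.2 (by linarith [hs.2])
  rw [hgs.gain_eq hφ hq, hhs.gain_eq hφ hq, ← mul_sub, norm_mul, norm_mul,
    Real.norm_of_nonneg (Real.exp_pos _).le, Real.norm_of_nonneg hw.le, mul_assoc]
  refine (mul_le_of_le_one_left (by positivity) h1).trans ?_
  exact hLip _ _ _ (hgs.avg hφ y) (hhs.avg hφ y) (hg.mass s hs0 hsτ y) (hh.mass s hs0 hsτ y)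
    (hgs.abs_avg_sub_le hφ hhs (hgh s hs0 hsτ) y) v

end Tame

/-- An initial datum with a lower bound `a` and weighted upper bounds `N q`. -/
structure IsDatum (f₀ : Torus d → Vel d → ℝ) (a : Vel d → ℝ) (N : ℕ → ℝ) : Prop where
  measurable : Measurable fun p : Torus d × Vel d => f₀ p.1 p.2
  integrable : Integrable a
  nonneg : ∀ v, 0 ≤ a v
  integral_pos : 0 < ∫ v, a v
  lower : ∀ x v, a v ≤ f₀ x v
  pos : ∀ q, 0 < N q
  upper : ∀ q x v, f₀ x v * weight q v ≤ N q

/-- Growth constants for the gain term. -/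
def IsGainConstant (d : ℕ) (C : ℕ → ℝ) : Prop :=
  ∀ q, 0 ≤ C q ∧ (d + 2 < q → ∀ (N : ℝ) (G : Vel d → ℝ), Controlled q N G → 0 < N →
    0 < mass G → ∀ v, localMaxwellian G v * weight q v ≤ C q * N)

lemma exists_isGainConstant (hd : 1 ≤ d) : ∃ C, IsGainConstant d C := by
  have h : ∀ q, ∃ C : ℝ, 0 ≤ C ∧ (d + 2 < q → ∀ (N : ℝ) (G : Vel d → ℝ), Controlled q N G →
      0 < N → 0 < mass G → ∀ v, localMaxwellian G v * weight q v ≤ C * N) := fun q => by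
    by_cases hq : d + 2 < q
    · obtain ⟨C, hC, h⟩ := exists_localMaxwellian_bound hd hq
      exact ⟨C, hC, fun _ => h⟩
    · exact ⟨0, le_rfl, fun h => absurd h hq⟩
  choose C hC using h
  exact ⟨C, hC⟩

/-- The bounds that are propagated by Duhamel's formula. -/
structure Propagated (a : Vel d → ℝ) (N C : ℕ → ℝ) (g : ℝ → Torus d → Vel d → ℝ) : Prop where
  measurable : Measurable fun p : ℝ × Torus d × Vel d => g p.1 p.2.1 p.2.2
  lower : ∀ t, 0 ≤ t → ∀ x v, Real.exp (-t) * a v ≤ g t x v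
  upper : ∀ q, d + 2 < q → ∀ t, 0 ≤ t → ∀ x v,
    g t x v * weight q v ≤ N q * Real.exp (C q * t)

section Propagated

variable {φ : Torus d → ℝ} {f₀ : Torus d → Vel d → ℝ} {a : Vel d → ℝ} {N C : ℕ → ℝ}
  {g : ℝ → Torus d → Vel d → ℝ} {q : ℕ}

lemma PhaseControlled.mono {M M' : ℝ} {g : Torus d → Vel d → ℝ} (hg : PhaseControlled q M g)
    (h : M ≤ M') : PhaseControlled q M' g :=
  ⟨hg.measurable, hg.nonneg, fun x v => (hg.le x v).trans h⟩

lemma Propagated.controlled (ha : ∀ v, 0 ≤ a v) (hg : Propagated a N C g) (hq : d + 2 < q)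
    {t : ℝ} (ht : 0 ≤ t) : PhaseControlled q (N q * Real.exp (C q * t)) (g t) where
  measurable := hg.measurable.comp measurable_prodMk_left
  nonneg x v := (mul_nonneg (Real.exp_pos _).le (ha v)).trans (hg.lower t ht x v)
  le x v := hg.upper q hq t ht x v

lemma Propagated.le_mass_avg (hf : IsDatum f₀ a N) (hφ : IsSmearing φ)
    (hg : Propagated a N C g) {t : ℝ} (ht : 0 ≤ t) (x : Torus d) :
    Real.exp (-t) * ∫ v, a v ≤ mass (avg φ (g t) x) :=
  (hg.controlled hf.nonneg (show d + 2 < d + 3 by omega) ht).le_mass_avg hφ (by omega)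
    hf.integrable (hg.lower t ht) x

/-- The upper bound grows and the lower bound decays in time, so their values at `τ` serve on all of
`[0, τ]`. -/
lemma Propagated.tame (hf : IsDatum f₀ a N) (hC : IsGainConstant d C) (hφ : IsSmearing φ)
    (hg : Propagated a N C g) (hq : d + 2 < q) (τ : ℝ) :
    Tame φ q (N q * Real.exp (C q * τ)) (Real.exp (-τ) * ∫ v, a v) τ g where
  measurable := hg.measurable
  controlled s hs hsτ := (hg.controlled hf.nonneg hq hs).mono (by
    have := (hf.pos q).le
    have := (hC q).1
    gcongr)
  mass s hs hsτ x := (by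
    have := hf.integral_pos.le
    gcongr : _ ≤ Real.exp (-s) * ∫ v, a v).trans (hg.le_mass_avg hf hφ hs x)

lemma propagated_freeFlow (hf : IsDatum f₀ a N) (hC : IsGainConstant d C) :
    Propagated a N C (freeFlow f₀) where
  measurable := measurable_freeFlow hf.measurable
  lower t ht x v := mul_le_mul_of_nonneg_left (hf.lower _ v) (Real.exp_pos _).le
  upper q hq t ht x v := by
    have h0 : 0 ≤ f₀ (x - proj (t • v)) v := (hf.nonneg v).trans (hf.lower _ v)
    have h1 : Real.exp (-t) ≤ 1 := Real.exp_le_one_iff.2 (by linarith)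
    have h2 : 1 ≤ Real.exp (C q * t) := Real.one_le_exp (mul_nonneg (hC q).1 ht)
    have h3 := hf.upper q (x - proj (t • v)) v
    have hN := hf.pos q
    rw [freeFlow, mul_assoc]
    have h4 := mul_nonneg h0 (weight_pos q v).le
    nlinarith

lemma integral_mul_exp (c t : ℝ) :
    ∫ s in (0 : ℝ)..t, c * Real.exp (c * s) = Real.exp (c * t) - 1 := by
  have := intervalIntegral.integral_eq_sub_of_hasDerivAt (a := 0) (b := t)
    (f := fun s => Real.exp (c * s)) (f' := fun s => c * Real.exp (c * s))
    (fun s _ => by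
      have := ((hasDerivAt_id s).const_mul c).exp
      simpa [mul_comm] using this)
    ((by fun_prop : Continuous fun s => c * Real.exp (c * s)).intervalIntegrable _ _)
  simp [this]

/-- The upper bound reproduces itself because `N + ∫₀ᵗ C N e^{Cs} ds = N e^{Ct}`; the lower bound
survives because the gain is nonnegative. -/
lemma Propagated.duhamelMap (hf : IsDatum f₀ a N) (hC : IsGainConstant d C)
    (hφ : IsSmearing φ) (hg : Propagated a N C g) :
    Propagated a N C (duhamelMap φ f₀ g) where
  measurable := measurable_duhamelMap hφ hf.measurable hg.measurable
  lower t ht x v := by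
    refine (mul_le_mul_of_nonneg_left (hf.lower (x - proj (t • v)) v)
      (Real.exp_pos _).le).trans (le_add_of_nonneg_right ?_)
    refine setIntegral_nonneg measurableSet_Ioc fun s hs => ?_
    exact mul_nonneg (Real.exp_pos _).le (gain_nonneg hφ
      (hg.controlled hf.nonneg (show d + 2 < d + 3 by omega) hs.1.le).nonneg _ _)
  upper q hq t ht x v := by
    have h0 : 0 ≤ f₀ (x - proj (t • v)) v := (hf.nonneg v).trans (hf.lower _ v)
    have h1 : Real.exp (-t) ≤ 1 := Real.exp_le_one_iff.2 (by linarith)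
    have hw := weight_pos q v
    have k1 : Real.exp (-t) * f₀ (x - proj (t • v)) v * weight q v ≤ N q := by
      rw [mul_assoc]
      exact (mul_le_of_le_one_left (by positivity) h1).trans (hf.upper q _ v)
    have k2 : (∫ s in Set.Ioc 0 t,
        Real.exp (-(t - s)) * gain φ (g s) (x - proj ((t - s) • v)) v) * weight q v ≤
        N q * (Real.exp (C q * t) - 1) := by
      rw [← integral_mul_exp, ← integral_mul_const, ← intervalIntegral.integral_const_mul,
        intervalIntegral.integral_of_le ht]
      refine integral_mono_of_nonneg ?_ ?_ ?_
      · refine ae_restrict_of_forall_mem measurableSet_Ioc fun s hs => ?_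
        exact mul_nonneg (mul_nonneg (Real.exp_pos _).le (gain_nonneg hφ
          (hg.controlled hf.nonneg hq hs.1.le).nonneg _ _)) hw.le
      · exact (by fun_prop : Continuous fun s => N q * (C q * Real.exp (C q * s)))
          |>.integrableOn_Ioc
      · refine ae_restrict_of_forall_mem measurableSet_Ioc fun s hs => ?_
        have hgs := hg.controlled hf.nonneg hq hs.1.le
        have hm : 0 < mass (avg φ (g s) (x - proj ((t - s) • v))) :=
          (mul_pos (Real.exp_pos _) hf.integral_pos).trans_le (hg.le_mass_avg hf hφ hs.1.le _)
        have hb := (hC q).2 hq _ _ (hgs.avg hφ (x - proj ((t - s) • v)))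
          (mul_pos (hf.pos q) (Real.exp_pos _)) hm v
        rw [← hgs.gain_eq hφ hq] at hb
        have hg0 := gain_nonneg hφ hgs.nonneg (x - proj ((t - s) • v)) v
        simp only
        rw [mul_assoc]
        refine (mul_le_of_le_one_left (by positivity)
          (Real.exp_le_one_iff.2 (by linarith [hs.2]))).trans (hb.trans_eq ?_)
        ring
    rw [BGK.duhamelMap, add_mul]
    linarith

end Propagated

end BGK

/-! ### Picard iteration: existence and uniqueness. -/

namespace BGK

open Filter Topology

variable {d : ℕ}

/-- The Picard iterates of Duhamel's formula. -/
def picard (φ : Torus d → ℝ) (f₀ : Torus d → Vel d → ℝ) : ℕ → ℝ → Torus d → Vel d → ℝ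
  | 0 => freeFlow f₀
  | n + 1 => duhamelMap φ f₀ (picard φ f₀ n)

/-- The limit of the Picard iterates. -/
def solution (φ : Torus d → ℝ) (f₀ : Torus d → Vel d → ℝ) (t : ℝ) (x : Torus d) (v : Vel d) : ℝ :=
  limUnder atTop fun n => picard φ f₀ n t x v

lemma abs_sub_mul_le {x y w M : ℝ} (hx : 0 ≤ x) (hy : 0 ≤ y) (hw : 0 ≤ w) (hxM : x * w ≤ M)
    (hyM : y * w ≤ M) : |x - y| * w ≤ M := by
  have h1 := mul_nonneg hx hw
  have h2 := mul_nonneg hy hw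
  rw [← abs_of_nonneg hw, ← abs_mul, sub_mul, abs_le]
  constructor <;> linarith

section Picard

variable {φ : Torus d → ℝ} {f₀ : Torus d → Vel d → ℝ} {a : Vel d → ℝ} {N C : ℕ → ℝ}

lemma propagated_picard (hf : IsDatum f₀ a N) (hC : IsGainConstant d C) (hφ : IsSmearing φ)
    (n : ℕ) : Propagated a N C (picard φ f₀ n) := by
  induction n with
  | zero => exact propagated_freeFlow hf hC
  | succ n ih => exact ih.duhamelMap hf hC hφ

/-- The iterates are constant in `n` at negative times, so the limit exists at every `t` and is
jointly measurable on the whole line. -/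
lemma picard_of_neg {t : ℝ} (ht : t < 0) (n : ℕ) (x : Torus d) (v : Vel d) :
    picard φ f₀ n t x v = freeFlow f₀ t x v := by
  cases n with
  | zero => rfl
  | succ n => simp [picard, duhamelMap, freeFlow, Set.Ioc_eq_empty (not_lt.2 ht.le)]

/-- Tails of a multiple of the exponential series. -/
def expTail (M r : ℝ) (n : ℕ) : ℝ := ∑' k, M * (r ^ (n + k) / (n + k).factorial)

lemma summable_mul_pow_div_factorial (M r : ℝ) :
    Summable fun n : ℕ => M * (r ^ n / n.factorial) :=
  (Real.summable_pow_div_factorial r).mul_left M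

lemma tendsto_expTail (M r : ℝ) : Tendsto (expTail M r) atTop (𝓝 0) := by
  have := tendsto_sum_nat_add fun n : ℕ => M * (r ^ n / n.factorial)
  refine this.congr fun n => ?_
  simp only [expTail, add_comm]

lemma exists_picard_bound (hd : 1 ≤ d) (hf : IsDatum f₀ a N) (hC : IsGainConstant d C)
    (hφ : IsSmearing φ) {q : ℕ} (hq : d + 2 < q) (τ : ℝ) :
    ∃ M r : ℝ, ∀ t, 0 ≤ t → t ≤ τ → ∀ x v n,
      |picard φ f₀ n t x v - picard φ f₀ (n + 1) t x v| * weight q v ≤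
        M * (r ^ n / n.factorial) := by
  have hN : 0 < N q * Real.exp (C q * τ) := mul_pos (hf.pos q) (Real.exp_pos _)
  obtain ⟨L, hL, hcontr⟩ := exists_duhamelMap_contraction hd hq hN
    (mul_pos (Real.exp_pos (-τ)) hf.integral_pos)
  have htame := fun n => (propagated_picard hf hC hφ n).tame hf hC hφ hq τ
  set M := N q * Real.exp (C q * τ)
  have key : ∀ n t, 0 ≤ t → t ≤ τ → ∀ x v,
      |picard φ f₀ n t x v - picard φ f₀ (n + 1) t x v| * weight q v ≤
        M * ((L * t) ^ n / n.factorial) := by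
    intro n
    induction n with
    | zero =>
      intro t ht htτ x v
      have h0 := (htame 0).controlled t ht htτ
      have h1 := (htame 1).controlled t ht htτ
      simpa using abs_sub_mul_le (h0.nonneg x v) (h1.nonneg x v) (weight_pos q v).le
        (h0.le x v) (h1.le x v)
    | succ n ih =>
      exact hcontr φ f₀ τ _ _ M n hφ (htame n) (htame (n + 1)) ih
  -- Replacing `t` by `τ` makes the summable bound uniform in time.
  refine ⟨M, L * τ, fun t ht htτ x v n => (key n t ht htτ x v).trans ?_⟩
  gcongr

lemma tendsto_picard (hd : 1 ≤ d) (hf : IsDatum f₀ a N) (hC : IsGainConstant d C)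
    (hφ : IsSmearing φ) (t : ℝ) (x : Torus d) (v : Vel d) :
    Tendsto (fun n => picard φ f₀ n t x v) atTop (𝓝 (solution φ f₀ t x v)) := by
  refine tendsto_nhds_limUnder ?_
  rcases lt_or_ge t 0 with ht | ht
  · exact ⟨_, tendsto_const_nhds.congr fun n => (picard_of_neg ht n x v).symm⟩
  · obtain ⟨M, r, h⟩ := exists_picard_bound hd hf hC hφ (show d + 2 < d + 3 by omega) t
    refine cauchySeq_tendsto_of_complete (cauchySeq_of_dist_le_of_summable _ (fun n => ?_)
      (summable_mul_pow_div_factorial M r))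
    exact (le_mul_of_one_le_right (abs_nonneg _) (one_le_weight _ v)).trans (h t ht le_rfl x v n)

lemma propagated_solution (hd : 1 ≤ d) (hf : IsDatum f₀ a N) (hC : IsGainConstant d C)
    (hφ : IsSmearing φ) : Propagated a N C (solution φ f₀) where
  measurable := measurable_of_tendsto_metrizable
    (fun n => (propagated_picard hf hC hφ n).measurable)
    (tendsto_pi_nhds.2 fun p => tendsto_picard hd hf hC hφ p.1 p.2.1 p.2.2)
  lower t ht x v := ge_of_tendsto' (tendsto_picard hd hf hC hφ t x v)
    fun n => (propagated_picard hf hC hφ n).lower t ht x v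
  upper q hq t ht x v := le_of_tendsto' ((tendsto_picard hd hf hC hφ t x v).mul_const _)
    fun n => (propagated_picard hf hC hφ n).upper q hq t ht x v

/-- The iterates approach the limit uniformly in the weighted norm, at distance at most `expTail M r
n`; the contraction estimate carries this convergence through the Duhamel map. -/
lemma solution_eq_duhamelMap (hd : 1 ≤ d) (hf : IsDatum f₀ a N) (hC : IsGainConstant d C)
    (hφ : IsSmearing φ) {t : ℝ} (ht : 0 ≤ t) (x : Torus d) (v : Vel d) :
    solution φ f₀ t x v = duhamelMap φ f₀ (solution φ f₀) t x v := by
  have hq : d + 2 < d + 3 := by omega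
  obtain ⟨M, r, hM⟩ := exists_picard_bound hd hf hC hφ hq t
  obtain ⟨L, hL, hcontr⟩ := exists_duhamelMap_contraction hd hq
    (mul_pos (hf.pos (d + 3)) (Real.exp_pos (C (d + 3) * t)))
    (mul_pos (Real.exp_pos (-t)) hf.integral_pos)
  have htame := fun n => (propagated_picard hf hC hφ n).tame hf hC hφ hq t
  have htame' := (propagated_solution hd hf hC hφ).tame hf hC hφ hq t
  have close : ∀ n s, 0 ≤ s → s ≤ t → ∀ x v,
      |picard φ f₀ n s x v - solution φ f₀ s x v| * weight (d + 3) v ≤ expTail M r n := by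
    intro n s hs hst x v
    have hw := weight_pos (d + 3) v
    have := dist_le_tsum_of_dist_le_of_tendsto
      (f := fun n => picard φ f₀ n s x v * weight (d + 3) v) _ (fun n => by
        rw [Real.dist_eq, ← sub_mul, abs_mul, abs_of_pos hw]
        exact hM s hs hst x v n) (summable_mul_pow_div_factorial M r)
      ((tendsto_picard hd hf hC hφ s x v).mul_const (weight (d + 3) v)) n
    rwa [Real.dist_eq, ← sub_mul, abs_mul, abs_of_pos hw] at this
  have hlim : Tendsto (fun n => picard φ f₀ (n + 1) t x v) atTop
      (𝓝 (duhamelMap φ f₀ (solution φ f₀) t x v)) := by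
    rw [tendsto_iff_dist_tendsto_zero]
    have h0 := (tendsto_expTail M r).mul_const (L * t)
    rw [zero_mul] at h0
    refine squeeze_zero (fun _ => dist_nonneg) (fun n => ?_) h0
    -- Order zero of the contraction estimate takes a bound constant in time as its input.
    have := hcontr φ f₀ t _ _ (expTail M r n) 0 hφ (htame n) htame'
      (fun s hs hst x v => by simpa using close n s hs hst x v) t ht le_rfl x v
    refine (le_mul_of_one_le_right dist_nonneg (one_le_weight (d + 3) v)).trans ?_
    simpa [Real.dist_eq, picard] using this
  exact tendsto_nhds_unique ((tendsto_add_atTop_iff_nat 1).2 (tendsto_picard hd hf hC hφ t x v))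
    hlim

lemma isMildSolution_solution (hd : 1 ≤ d) (hf : IsDatum f₀ a N) (hC : IsGainConstant d C)
    (hφ : IsSmearing φ) : IsMildSolution φ f₀ (solution φ f₀) := by
  have hq : d + 2 < d + 3 := by omega
  have hg := propagated_solution hd hf hC hφ
  refine ⟨hg.measurable, fun t ht => (hg.controlled hf.nonneg hq ht).nonneg, fun t ht => ?_,
    fun t ht x v => ?_, fun t ht x v => ?_⟩
  · have hc := hg.controlled hf.nonneg hq ht
    have hdom : Integrable (fun p : Torus d × Vel d => (1 : ℝ) * (N (d + 3) *
        Real.exp (C (d + 3) * t) * ((1 + ‖p.2‖ ^ 2) / weight (d + 3) p.2))) :=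
      (integrable_const (1 : ℝ)).mul_prod ((integrable_weightMoment hq).const_mul _)
    refine hdom.mono' (hc.measurable.mul (by fun_prop)).aestronglyMeasurable
      (Eventually.of_forall fun p => ?_)
    have h0 := hc.nonneg p.1 p.2
    rw [Real.norm_of_nonneg (by positivity), one_mul]
    exact mul_le_weightMoment p.2 (hc.le p.1 p.2) h0 le_rfl
  · rw [intervalIntegrable_iff_integrableOn_Ioc_of_le ht]
    exact (hg.tame hf hC hφ hq t).integrableOn hd hq
      (mul_pos (hf.pos (d + 3)) (Real.exp_pos _))
      (mul_pos (Real.exp_pos (-t)) hf.integral_pos) hφ le_rfl x v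
  · rw [intervalIntegral.integral_of_le ht]
    exact solution_eq_duhamelMap hd hf hC hφ ht x v

end Picard

section Uniqueness

variable {φ : Torus d → ℝ} {f₀ : Torus d → Vel d → ℝ} {a : Vel d → ℝ} {N C : ℕ → ℝ}
  {h : ℝ → Torus d → Vel d → ℝ} {q : ℕ}

lemma IsMildSolution.eq_duhamelMap (hh : IsMildSolution φ f₀ h) {t : ℝ} (ht : 0 ≤ t)
    (x : Torus d) (v : Vel d) : h t x v = duhamelMap φ f₀ h t x v := by
  rw [hh.duhamel t ht x v, intervalIntegral.integral_of_le ht, duhamelMap]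

/-- The lower bound holds for every mild solution, so a competitor in the uniqueness class only has
to be bounded from above. -/
lemma IsMildSolution.exp_neg_mul_le (hh : IsMildSolution φ f₀ h) (hφ : IsSmearing φ)
    (hf : IsDatum f₀ a N) {t : ℝ} (ht : 0 ≤ t) (x : Torus d) (v : Vel d) :
    Real.exp (-t) * a v ≤ h t x v := by
  rw [hh.eq_duhamelMap ht]
  refine (mul_le_mul_of_nonneg_left (hf.lower (x - proj (t • v)) v)
    (Real.exp_pos _).le).trans (le_add_of_nonneg_right ?_)
  exact setIntegral_nonneg measurableSet_Ioc fun s hs =>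
    mul_nonneg (Real.exp_pos _).le (gain_nonneg hφ (hh.nonneg s hs.1.le) _ _)

lemma IsMildSolution.tame (hh : IsMildSolution φ f₀ h) (hφ : IsSmearing φ)
    (hf : IsDatum f₀ a N) (hq : d + 2 < q) {τ M : ℝ}
    (hM : ∀ s, 0 ≤ s → s ≤ τ → ∀ x v, h s x v * weight q v ≤ M) :
    Tame φ q M (Real.exp (-τ) * ∫ v, a v) τ h := by
  have hc : ∀ s, 0 ≤ s → s ≤ τ → PhaseControlled q M (h s) := fun s hs hsτ =>
    ⟨hh.measurable.comp measurable_prodMk_left, hh.nonneg s hs, hM s hs hsτ⟩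
  refine ⟨hh.measurable, hc, fun s hs hsτ x => ?_⟩
  have := hf.integral_pos.le
  exact (by gcongr : _ ≤ Real.exp (-s) * ∫ v, a v).trans
    ((hc s hs hsτ).le_mass_avg hφ hq hf.integrable (hh.exp_neg_mul_le hφ hf hs) x)

/-- Two solutions are fixed points of the Duhamel map, so their weighted distance is at most `M (L
t)^n / n!` for every `n`, hence zero. -/
lemma IsMildSolution.eq_of_weight_le {g : ℝ → Torus d → Vel d → ℝ} (hd : 1 ≤ d)
    (hφ : IsSmearing φ) (hf : IsDatum f₀ a N) (hq : d + 2 < q) (hg : IsMildSolution φ f₀ g)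
    (hh : IsMildSolution φ f₀ h) {τ M : ℝ} (hM : 0 < M)
    (hgM : ∀ s, 0 ≤ s → s ≤ τ → ∀ x v, g s x v * weight q v ≤ M)
    (hhM : ∀ s, 0 ≤ s → s ≤ τ → ∀ x v, h s x v * weight q v ≤ M)
    {t : ℝ} (ht : 0 ≤ t) (htτ : t ≤ τ) (x : Torus d) (v : Vel d) : h t x v = g t x v := by
  obtain ⟨L, hL, hcontr⟩ := exists_duhamelMap_contraction hd hq hM
    (mul_pos (Real.exp_pos (-τ)) hf.integral_pos)
  have hgt := hg.tame hφ hf hq hgM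
  have hht := hh.tame hφ hf hq hhM
  have key : ∀ n s, 0 ≤ s → s ≤ τ → ∀ x v,
      |h s x v - g s x v| * weight q v ≤ M * ((L * s) ^ n / n.factorial) := by
    intro n
    induction n with
    | zero =>
      intro s hs hsτ x v
      simpa using abs_sub_mul_le (hh.nonneg s hs x v) (hg.nonneg s hs x v) (weight_pos q v).le
        (hhM s hs hsτ x v) (hgM s hs hsτ x v)
    | succ n ih =>
      intro s hs hsτ x v
      rw [hh.eq_duhamelMap hs, hg.eq_duhamelMap hs]
      exact hcontr φ f₀ τ _ _ M n hφ hht hgt ih s hs hsτ x v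
  have hlim := (summable_mul_pow_div_factorial M (L * t)).tendsto_atTop_zero
  have h0 : |h t x v - g t x v| * weight q v ≤ 0 :=
    ge_of_tendsto' hlim fun n => key n t ht htτ x v
  have h1 : |h t x v - g t x v| ≤ 0 :=
    (le_mul_of_one_le_right (abs_nonneg _) (one_le_weight q v)).trans h0
  exact sub_eq_zero.1 (abs_eq_zero.1 (le_antisymm h1 (abs_nonneg _)))

lemma weight_le_of_iSup_lt_top {τ : ℝ}
    (hsup : (⨆ t ∈ Set.Icc 0 τ, weightedSup q (h t)) < ⊤) :
    ∃ M : ℝ, ∀ s, 0 ≤ s → s ≤ τ → ∀ x v, h s x v * weight q v ≤ M := by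
  refine ⟨(⨆ t ∈ Set.Icc 0 τ, weightedSup q (h t)).toReal, fun s hs hsτ x v => ?_⟩
  rw [← ENNReal.ofReal_le_iff_le_toReal hsup.ne]
  have h1 : ENNReal.ofReal (h s x v * weight q v) ≤ weightedSup q (h s) :=
    le_iSup₂ (f := fun x v => ENNReal.ofReal (h s x v * (1 + ‖v‖ ^ q))) x v
  exact h1.trans (le_iSup₂ (f := fun t (_ : t ∈ Set.Icc 0 τ) => weightedSup q (h t)) s ⟨hs, hsτ⟩)

end Uniqueness

lemma exists_isDatum {f₀ : Torus d → Vel d → ℝ}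
    (hf₀_meas : Measurable fun p : Torus d × Vel d => f₀ p.1 p.2)
    {a : Vel d → ℝ} {C₁ α : ℝ} (hC₁ : 0 < C₁) (hα : 0 < α)
    (ha_nonneg : ∀ v, 0 ≤ a v) (ha_pos : 0 < ∫ v, a v) (hf₀_lower : ∀ x v, a v ≤ f₀ x v)
    (hf₀_upper : ∀ x v, f₀ x v ≤ C₁ * Real.exp (-α * ‖v‖ ^ 2)) :
    ∃ N, IsDatum f₀ a N := by
  -- The rescaling `s = b |v|` turns `s² / 2` into `α |v|²`.
  set b := √(2 * α)
  have hb : 0 < b := Real.sqrt_pos.2 (by positivity)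
  have hb2 : b ^ 2 = 2 * α := Real.sq_sqrt (by positivity)
  refine ⟨fun q => C₁ * (1 + 2 ^ q * q.factorial / b ^ q), hf₀_meas, ?_, ha_nonneg, ha_pos,
    hf₀_lower, fun q => by positivity, fun q x v => ?_⟩
  -- If `a` were not integrable, its integral would be zero by convention, contradicting positivity.
  · by_contra h
    rw [integral_undef h] at ha_pos
    exact lt_irrefl _ ha_pos
  · have h1 := pow_mul_exp_neg_sq_le q (s := b * ‖v‖) (by positivity)
    have e1 : -((b * ‖v‖) ^ 2 / 2) = -α * ‖v‖ ^ 2 := by rw [mul_pow, hb2]; ring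
    rw [e1, mul_pow] at h1
    have h2 : Real.exp (-α * ‖v‖ ^ 2) ≤ 1 := Real.exp_le_one_iff.2 (by
      have : 0 ≤ α * ‖v‖ ^ 2 := by positivity
      linarith)
    have h3 : ‖v‖ ^ q * Real.exp (-α * ‖v‖ ^ 2) ≤ 2 ^ q * q.factorial / b ^ q := by
      rw [le_div_iff₀ (by positivity)]; linarith
    calc f₀ x v * weight q v ≤ C₁ * Real.exp (-α * ‖v‖ ^ 2) * weight q v :=
          mul_le_mul_of_nonneg_right (hf₀_upper x v) (weight_pos q v).le
      _ = C₁ * (Real.exp (-α * ‖v‖ ^ 2) + ‖v‖ ^ q * Real.exp (-α * ‖v‖ ^ 2)) := by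
          unfold weight; ring
      _ ≤ _ := by gcongr

end BGK

end

/-! ### Choice of the constants and conclusion. -/

theorem mainTheorem4 (d : ℕ) (hd : 1 ≤ d)
    (f₀ : BGK.Torus d → BGK.Vel d → ℝ)
    (hf₀_meas : Measurable (fun p : BGK.Torus d × BGK.Vel d => f₀ p.1 p.2))
    (hf₀_prob : ∫ p : BGK.Torus d × BGK.Vel d, f₀ p.1 p.2 = 1)
    (a : BGK.Vel d → ℝ) (C₁ α : ℝ) (hC₁ : 0 < C₁) (hα : 0 < α)
    (ha_cont : Continuous a) (ha_nonneg : ∀ v, 0 ≤ a v) (ha_pos : 0 < ∫ v, a v)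
    (hf₀_lower : ∀ x v, a v ≤ f₀ x v)
    (hf₀_upper : ∀ x v, f₀ x v ≤ C₁ * Real.exp (-α * ‖v‖ ^ 2)) :
    ∃ (K : ℕ → ℝ → ℝ) (A : ℝ → ℝ),
      (∀ q, MonotoneOn (K q) (Set.Ici 0)) ∧
      AntitoneOn A (Set.Ici 0) ∧
      (∀ t, 0 ≤ t → 0 < A t) ∧
      ∀ φ : BGK.Torus d → ℝ, BGK.IsSmearing φ →
        ∃ g : ℝ → BGK.Torus d → BGK.Vel d → ℝ,
          BGK.IsMildSolution φ f₀ g ∧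
          (∀ (q : ℕ) (t : ℝ), 0 ≤ t → ∀ x,
            ENNReal.ofReal (‖BGK.smVelocity φ (g t) x‖ + BGK.smTemperature φ (g t) x) +
              BGK.weightedSup q (g t) ≤ ENNReal.ofReal (K q t)) ∧
          (∀ t : ℝ, 0 ≤ t → ∀ x,
            (∫ v, a v) * Real.exp (-t) ≤ BGK.density (g t) x ∧
            (∫ v, a v) * Real.exp (-t) ≤ BGK.smDensity φ (g t) x ∧
            A t ≤ BGK.smTemperature φ (g t) x) ∧
          (∀ h : ℝ → BGK.Torus d → BGK.Vel d → ℝ, BGK.IsMildSolution φ f₀ h →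
            (∃ q : ℕ, d + 2 < q ∧
              ∀ τ : ℝ, 0 < τ → (⨆ t ∈ Set.Icc 0 τ, BGK.weightedSup q (h t)) < ⊤) →
            ∀ t : ℝ, 0 ≤ t → ∀ x v, h t x v = g t x v) := by
  open BGK in
  obtain ⟨N, hf⟩ := exists_isDatum hf₀_meas hC₁ hα ha_nonneg ha_pos hf₀_lower hf₀_upper
  obtain ⟨C, hC⟩ := exists_isGainConstant hd
  have hp : d + 2 < d + 3 := by omega
  have hκ := weightMoment_pos hp
  set p := d + 3
  set B : ℕ → ℝ → ℝ := fun q t => N q * Real.exp (C q * t) with hB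
  have hBpos : ∀ q t, 0 < B q t := fun q t => mul_pos (hf.pos q) (Real.exp_pos _)
  have hBmono : ∀ q {s t : ℝ}, s ≤ t → B q s ≤ B q t := fun q s t hst => by
    have := (hC q).1
    have := (hf.pos q).le
    simp only [hB]
    gcongr
  set m : ℝ → ℝ := fun t => Real.exp (-t) * ∫ v, a v with hm
  have hmpos : ∀ t, 0 < m t := fun t => mul_pos (Real.exp_pos _) ha_pos
  have hmanti : ∀ {s t : ℝ}, s ≤ t → m t ≤ m s := fun {s t} hst => by
    simp only [hm]
    gcongr
  -- The first two terms bound velocity plus temperature. The last bounds the weighted supremum: the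
  -- order is raised to `q + p`, which exceeds `d + 2` for every `q`, and the comparison of weights
  -- costs the factor 2.
  set K : ℕ → ℝ → ℝ := fun q t =>
    1 + B p t * weightMoment d p / m t + 2 * B (q + p) t with hK
  set A : ℝ → ℝ := fun t => tempLower d (m t) (B p t) with hA
  refine ⟨K, A, fun q s _ t _ hst => ?_, fun s _ t _ hst => ?_,
    fun t _ => tempLower_pos hd (hmpos t) (hBpos p t), fun φ hφ => ?_⟩
  · have h1 := hmanti hst
    have h2 := hBmono p hst
    have h3 := hBmono (q + p) hst
    have h4 := hmpos t
    have h5 := hBpos p t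
    simp only [hK]
    gcongr
  · exact tempLower_le (hmpos t).le (hmanti hst) (hBpos p s) (hBmono p hst)
  have hg := propagated_solution hd hf hC hφ
  have hgm := isMildSolution_solution hd hf hC hφ
  refine ⟨solution φ f₀, hgm, fun q t ht x => ?_, fun t ht x => ?_, fun h hh hhq t ht x v => ?_⟩
  · have hc := hg.controlled hf.nonneg hp ht
    have hav := hc.avg hφ x
    have hmass := hg.le_mass_avg hf hφ ht x
    have hmass0 := (hmpos t).trans_le hmass
    have h1 := hav.norm_mean_add_temp_le hp hd hmass0
    have h2 : B p t * weightMoment d p / mass (avg φ (solution φ f₀ t) x) ≤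
        B p t * weightMoment d p / m t := by
      have h4 := hmpos t
      have h5 := hBpos p t
      gcongr
    rw [hc.smVelocity_eq hφ hp, hc.smTemperature_eq hφ hp]
    have h3 : weightedSup q (solution φ f₀ t) ≤ ENNReal.ofReal (2 * B (q + p) t) := by
      refine iSup₂_le fun x v => ENNReal.ofReal_le_ofReal ?_
      have hq' : d + 2 < q + p := by omega
      have hn := hc.nonneg x v
      calc solution φ f₀ t x v * (1 + ‖v‖ ^ q)
          ≤ solution φ f₀ t x v * (2 * weight (q + p) v) :=
            mul_le_mul_of_nonneg_left (weight_le_two_mul_weight (by omega) v) hn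
        _ = 2 * (solution φ f₀ t x v * weight (q + p) v) := by ring
        _ ≤ _ := by
            have := hg.upper (q + p) hq' t ht x v
            simp only [hB]
            linarith
    have hpos : 0 ≤ B p t * weightMoment d p / m t := by
      have h4 := hmpos t
      have h5 := hBpos p t
      positivity
    simp only [hK]
    have hsum : 0 ≤ 1 + B p t * weightMoment d p / m t := by linarith
    have hB0 : 0 ≤ 2 * B (q + p) t := by linarith [hBpos (q + p) t]
    rw [ENNReal.ofReal_add hsum hB0]
    have h4 := h1.trans (add_le_add_right h2 1)
    exact add_le_add (ENNReal.ofReal_le_ofReal h4) h3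
  · have hc := hg.controlled hf.nonneg hp ht
    have hav := hc.avg hφ x
    have hmass := hg.le_mass_avg hf hφ ht x
    have hmass0 := (hmpos t).trans_le hmass
    refine ⟨?_, ?_, ?_⟩
    · rw [mul_comm, ← integral_const_mul]
      exact integral_mono (hf.integrable.const_mul _) ((hc.controlled x).integrable hp)
        fun v => hg.lower t ht x v
    · rw [mul_comm, hc.smDensity_eq hφ hp]
      exact hmass
    · rw [hc.smTemperature_eq hφ hp]
      exact (tempLower_le (hmpos t).le hmass (hBpos p t) le_rfl).trans
        (hav.tempLower_le_temp hp hd (hBpos p t) hmass0)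
  · obtain ⟨q, hq, hsup⟩ := hhq
    -- The horizon `t + 1` is positive even when `t = 0`.
    obtain ⟨M, hM⟩ := weight_le_of_iSup_lt_top (hsup (t + 1) (by linarith))
    exact hgm.eq_of_weight_le hd hφ hf hq hh (τ := t + 1) (M := max M (B q (t + 1)))
      (lt_max_of_lt_right (hBpos q _))
      (fun s hs hst x v => (hg.upper q hq s hs x v).trans
        ((hBmono q hst).trans (le_max_right _ _)))
      (fun s hs hst x v => (hM s hs hst x v).trans (le_max_left _ _)) ht (by linarith) x v
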